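/- All logarithms are to base 2, and sequences are binary. For $x=x_1\cdots x_n\in\{0,1\}^n$ let $\mathrm{VT}^0(x)=\sum_{i=1}^n x_i$ and, for $k\ge 1$, $\mathrm{VT}^k(x)=\sum_{i=1}^n\big(\sum_{j=1}^i j^{k-1}\big)x_i$. Let $\mathcal{B}(x)$ be the set of all sequences obtained from $x$ by exactly one deletion followed by at most one substitution. A code $\mathcal{C}\subseteq\{0,1\}^n$ is an $(n,N;\mathcal{B})$-reconstruction code if $|\mathcal{B}(x)\cap\mathcal{B}(y)|<N$ for all distinct $x,y\in\mathcal{C}$; its redundancy is $\mathrm{red}(\mathcal{C})=n-\log|\mathcal{C}|$. The period of a sequence $w$ is the least $p\ge 1$ with $w_i=w_{i+p}$ whenever $1\le i\le |w|-p$, and $\mathcal{R}(n,2,t)$ is the set of $x\in\{0,1\}^n$ all of whose substrings (of consecutive symbols) with period at most 2 have length at most $t$. For $P\ge1$ and $i\ge 1$ let $x^{(P,i)}=x_{(i-1)P+1}\cdots x_{iP}$ if $i\le\lfloor n/P\rfloor$, let $x^{(P,\lfloor n/P\rfloor+1)}=x_{\lfloor n/P\rfloor P+1}\cdots x_n$ (possibly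 empty), and let $x^{(P,i)}$ be empty for larger $i$. Theorem. Let $n\ge1$, $t=\lceil\log n\rceil+3$ and $P=6t+4$. For integers $s_0\in[0,3]$, $s_1\in[0,2n-1]$ and $g_k,g_k'\in[0,3(2P)^k-1]$ ($k=1,2,3$), let $\mathcal{C}(n,11,\mathcal{B})$ be the set of all $x\in\mathcal{R}(n,2,t)$ such that $$\mathrm{VT}^0(x)\equiv s_0\pmod 4,\qquad \mathrm{VT}^1(x)\equiv s_1\pmod{2n},$$ and, for $k\in\{1,2,3\}$, $$\sum_{i\ge1}\mathrm{VT}^k\big(x^{(P,2i-1)}x^{(P,2i)}\big)\equiv g_k,\qquad \sum_{i\ge1}\mathrm{VT}^k\big(x^{(P,2i)}x^{(P,2i+1)}\big)\equiv g_k'\pmod{3(2P)^k}.$$ Then, for every choice of these parameters, $\mathcal{C}(n,11,\mathcal{B})$ is an $(n,11;\mathcal{B})$-reconstruction code. Moreover, there is an absolute constant $K$ such that for every $n\ge2$ the parameters can be chosen so that $\mathcal{C}(n,11,\mathcal{B})$ is non-empty and $$\mathrm{red}(\mathcal{C}(n,11,\mathcal{B}))\le\log n+12\log\log n+K.$$ 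-/

import Mathlib

namespace Recon

/-- `Σ^n`: the binary sequences of length `n`. -/
def Words (n : ℕ) : Set (List Bool) := {x | x.length = n}

/-- The Hamming distance of two sequences (used for sequences of the same length). -/
def hdist (x y : List Bool) : ℕ := (x.zip y).countP (fun p => p.1 != p.2)

/-- The single-deletion ball: the subsequences of `x` that are shorter by exactly one. -/
def delBall (x : List Bool) : Set (List Bool) :=
  {y | y.length + 1 = x.length ∧ y.Sublist x}

/-- The single-substitution ball: same length and Hamming distance at most one. -/
def subBall (x : List Bool) : Set (List Bool) :=
  {y | y.length = x.length ∧ hdist x y ≤ 1}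

/-- The single-deletion single-substitution ball: one deletion followed by one substitution
(a substitution may leave the sequence unchanged). -/
def dsBall (x : List Bool) : Set (List Bool) :=
  {z | ∃ y ∈ delBall x, z ∈ subBall y}

/-- `C` is an `(n, N; B)`-reconstruction code. -/
def IsReconstructionCode (n N : ℕ) (C : Set (List Bool)) : Prop :=
  C ⊆ Words n ∧ ∀ x ∈ C, ∀ y ∈ C, x ≠ y → (dsBall x ∩ dsBall y).encard < (N : ℕ∞)

/-- The redundancy `n - log₂ |C|` of a code `C ⊆ Σ^n`. -/
noncomputable def redundancy (n : ℕ) (C : Set (List Bool)) : ℝ :=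
  (n : ℝ) - Real.logb 2 (C.ncard : ℝ)

/-- The `k`-th order VT syndrome: the weight for `k = 0`, and
`∑_{i=1}^n ∑_{j=1}^i j^(k-1) x_i` for `k ≥ 1`. The index `i : Fin x.length` stands for the
position `i + 1`. -/
def vt : ℕ → List Bool → ℕ
  | 0, x => ∑ i : Fin x.length, (x.get i).toNat
  | k + 1, x => ∑ i : Fin x.length, ∑ j ∈ Finset.Icc 1 ((i : ℕ) + 1), j ^ k * (x.get i).toNat

/-- `x_i = x_{i+p}` whenever both positions exist. -/
def ShiftInvariant (p : ℕ) (x : List Bool) : Prop :=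
  ∀ i, i + p < x.length → x[i]? = x[i + p]?

/-- `p` is the period of `x`: the smallest positive shift that leaves `x` invariant. -/
def HasPeriod (p : ℕ) (x : List Bool) : Prop :=
  IsLeast {q | 0 < q ∧ ShiftInvariant q x} p

/-- `R(n, t', t)`: the sequences of length `n` in which every substring of period at most `t'`
has length at most `t`. -/
def periodBounded (n t' t : ℕ) : Set (List Bool) :=
  {x | x ∈ Words n ∧ ∀ w : List Bool, w <:+: x → (∃ p ≤ t', HasPeriod p w) → w.length ≤ t}

/-- The code `C₁`. -/
def codeVT (n s₀ s₁ : ℕ) : Set (List Bool) :=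
  {x | x ∈ Words n ∧ vt 0 x ≡ s₀ [MOD 4] ∧ vt 1 x ≡ s₁ [MOD 2 * n]}

/-- The `i`-th block (`i ≥ 1`) of `x` cut into blocks of length `P`: the positions
`(i-1)P+1, …, iP` as far as they exist. The block number `⌊n/P⌋ + 1` is the (possibly empty)
remainder, and later blocks are empty. -/
def block (P : ℕ) (x : List Bool) (i : ℕ) : List Bool :=
  (x.drop ((i - 1) * P)).take P

/-- `∑_i VT^k(x^{(P,2i-1)} x^{(P,2i)})`; for `k ≥ 1` the pairs of empty blocks contribute `0`. -/
def oddBlockSum (P k : ℕ) (x : List Bool) : ℕ :=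
  ∑ i ∈ Finset.Icc 1 (x.length / P + 1), vt k (block P x (2 * i - 1) ++ block P x (2 * i))

/-- `∑_i VT^k(x^{(P,2i)} x^{(P,2i+1)})`. -/
def evenBlockSum (P k : ℕ) (x : List Bool) : ℕ :=
  ∑ i ∈ Finset.Icc 1 (x.length / P + 1), vt k (block P x (2 * i) ++ block P x (2 * i + 1))

/-- The code given by the VT constraints of orders 1, 2, 3 on pairs of consecutive blocks of
length `P`. The residues of order `k + 1` are `g k` and `g' k`. -/
def codeBlocks (n P : ℕ) (g g' : Fin 3 → ℕ) : Set (List Bool) :=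
  {x | x ∈ Words n ∧ ∀ k : Fin 3,
    oddBlockSum P ((k : ℕ) + 1) x ≡ g k [MOD 3 * (2 * P) ^ ((k : ℕ) + 1)] ∧
    evenBlockSum P ((k : ℕ) + 1) x ≡ g' k [MOD 3 * (2 * P) ^ ((k : ℕ) + 1)]}

/-- `t = ⌈log₂ n⌉ + 3`. -/
noncomputable def tParam (n : ℕ) : ℕ := ⌈Real.logb 2 (n : ℝ)⌉₊ + 3

/-- `P = 6 t + 4`. -/
noncomputable def pParam (n : ℕ) : ℕ := 6 * tParam n + 4

/-- The code `C(n, 11, B)` with parameters `s₀, s₁, g, g'`. -/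
noncomputable def code11 (n s₀ s₁ : ℕ) (g g' : Fin 3 → ℕ) : Set (List Bool) :=
  periodBounded n 2 (tParam n) ∩ codeVT n s₀ s₁ ∩ codeBlocks n (pParam n) g g'

/-- The ranges of the parameters. -/
def ValidParams (n s₀ s₁ : ℕ) (g g' : Fin 3 → ℕ) : Prop :=
  s₀ < 4 ∧ s₁ < 2 * n ∧
    ∀ k : Fin 3, g k < 3 * (2 * pParam n) ^ ((k : ℕ) + 1) ∧
      g' k < 3 * (2 * pParam n) ^ ((k : ℕ) + 1)

end Recon

/-! Let `x` and `y` be distinct words of the code with a common word `z` in their balls, and let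
S(m) be the weight of `x` minus the weight of `y` on the positions from m on. Comparing both words
with `z` writes S as a function with two unit steps, one for each substitution, plus a term confined
to [0, 1] or to [-1, 0]. Hence |S| is at most 3, and the weight condition mod 4 gives S(0) = 0. This
improves the bound to |S| ≤ 2 and leaves at most two sign changes. Since |∑ S| ≤ 2(n - 1), the
condition mod 2n gives ∑ S = 0. By Abel summation the differences of `x` and `y` have vanishing
moments of orders 0 and 1, so there are at least four of them (`exists_config`). Let f < f₂ be the
first two and l₂ < l the last two.

If l - f ≤ P, all differences lie in two consecutive blocks. The syndrome differences of that pair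
are the first three moments of S on the window. They are at most 2(2P)^k in absolute value, hence
zero, and a function with two sign changes is determined to be zero by three such moments. This
contradicts x(f) ≠ y(f) (`Config.not_codeBlocks`).

If l - f > 6t, the common words are counted. Split them according to which word has its deletion
further left. After the deletions the two words disagree in at most two places, because `z` is
within one substitution of each. With the deletion at i in `x` and j ≥ i in `y`, this forces i ≤ f
or l ≤ j, and the outer deletion may then be moved to f or to l respectively. With one deletion
fixed in this way at most five words remain, so each direction contributes at most 10
(`Config.encard_forwardSet_le`). If both directions occur, then outside a few positions two
alignments hold at once. Where a shift meets an equality or the opposite shift, the word has period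
at most 2, which the period bound forbids on long windows. Only alignments in which f and f₂, or l₂
and l, are the mismatches survive, and each direction contributes at most 4
(`Config.encard_forwardSet_le_four`). Thus there are never more than 10 common words.

For the redundancy, a union bound shows that at least half of all words satisfy the period bound.
The pigeonhole principle over the 5832 n (2P)^12 syndrome vectors, with P = O(log n), gives the
rest. -/

namespace Recon

/-! ### Two-sided infinite words and their common neighbours -/

/-- Deletion of the letter at position `i` of a two-sided infinite word. -/
def del (i : ℤ) (x : ℤ → Bool) : ℤ → Bool := fun m => if m < i then x m else x (m + 1)

/-- The word `x` with the letter at position `p` complemented. -/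
def flip (x : ℤ → Bool) (p : ℤ) : ℤ → Bool := fun m => if m = p then !x m else x m

/-- The words `u` and `v` differ in at most one position. -/
def Near (u v : ℤ → Bool) : Prop := ∃ p, ∀ m, m ≠ p → u m = v m

/-- The numerical value of a letter. -/
def val (x : ℤ → Bool) (m : ℤ) : ℤ := ((x m).toNat : ℤ)

/-- The mirror image of a word. -/
def rev (x : ℤ → Bool) : ℤ → Bool := fun m => x (-m)

/-- The words `z` obtained from `x` and from `y` by a deletion and at most one substitution, where
the deletion in `x` is not to the right of the deletion in `y`. -/
def forwardSet (x y : ℤ → Bool) : Set (ℤ → Bool) :=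
  {z | ∃ i j, i ≤ j ∧ Near z (del i x) ∧ Near z (del j y)}

/-- Every window of length `t + 1` inside `[f, l]` violates the period `2`. -/
def Aperiodic (t : ℤ) (x : ℤ → Bool) (f l : ℤ) : Prop :=
  ∀ a, f ≤ a → a + t ≤ l → ∃ k, a ≤ k ∧ k + 2 ≤ a + t ∧ x k ≠ x (k + 2)

/-- `f < f₂` are the first two and `l₂ < l` the last two positions in which `x` and `y` differ,
and the differences have vanishing moments of orders `0` and `1`. -/
structure Config (x y : ℤ → Bool) (f f₂ l₂ l : ℤ) : Prop where
  lt_first : f < f₂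
  lt_mid : f₂ < l₂
  lt_last : l₂ < l
  ne_f : x f ≠ y f
  ne_f₂ : x f₂ ≠ y f₂
  ne_l₂ : x l₂ ≠ y l₂
  ne_l : x l ≠ y l
  before : ∀ m, m < f → x m = y m
  gap_first : ∀ m, f < m → m < f₂ → x m = y m
  gap_last : ∀ m, l₂ < m → m < l → x m = y m
  after : ∀ m, l < m → x m = y m
  sum_zero : ∑ m ∈ Finset.Icc f l, (val x m - val y m) = 0
  sum_one : ∑ m ∈ Finset.Icc f l, (m * val x m - m * val y m) = 0

theorem del_of_lt {i m : ℤ} (x : ℤ → Bool) (h : m < i) : del i x m = x m := by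
  simp [del, h]

theorem del_of_le {i m : ℤ} (x : ℤ → Bool) (h : i ≤ m) : del i x m = x (m + 1) := by
  simp [del, not_lt.mpr h]

theorem del_eq_del {a b : ℤ} {x : ℤ → Bool} (hab : a ≤ b)
    (h : ∀ m, a ≤ m → m < b → x m = x (m + 1)) : del a x = del b x := by
  funext m
  rcases lt_or_ge m a with h1 | h1
  · rw [del_of_lt x h1, del_of_lt x (by omega)]
  · rcases lt_or_ge m b with h2 | h2
    · rw [del_of_le x h1, del_of_lt x h2, h m h1 h2]
    · rw [del_of_le x h1, del_of_le x h2]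

theorem val_nonneg (x : ℤ → Bool) (m : ℤ) : 0 ≤ val x m := by simp [val]

theorem val_le_one (x : ℤ → Bool) (m : ℤ) : val x m ≤ 1 := by
  unfold val; cases x m <;> simp

theorem val_eq_zero_or_one (x : ℤ → Bool) (m : ℤ) : val x m = 0 ∨ val x m = 1 := by
  unfold val; cases x m <;> simp

theorem val_congr {x y : ℤ → Bool} {m k : ℤ} (h : x m = y k) : val x m = val y k := by
  simp [val, h]

theorem val_sub_of_ne {x y : ℤ → Bool} {m k : ℤ} (h : x m ≠ y k) :
    val x m - val y k = 1 ∨ val x m - val y k = -1 := by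
  unfold val; revert h; cases x m <;> cases y k <;> simp

theorem Near.two_points {z u v : ℤ → Bool} (hu : Near z u) (hv : Near z v) :
    ∃ p q, ∀ m, u m ≠ v m → m = p ∨ m = q := by
  obtain ⟨p, hp⟩ := hu
  obtain ⟨q, hq⟩ := hv
  refine ⟨p, q, fun m hm => ?_⟩
  by_contra! h
  exact hm ((hp m h.1).symm.trans (hq m h.2))

theorem Near.not_three {z u v : ℤ → Bool} (hu : Near z u) (hv : Near z v) {a b c : ℤ}
    (ha : u a ≠ v a) (hb : u b ≠ v b) (hc : u c ≠ v c) (hab : a ≠ b) (hac : a ≠ c)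
    (hbc : b ≠ c) : False := by
  obtain ⟨p, q, h⟩ := hu.two_points hv
  have := h a ha
  have := h b hb
  have := h c hc
  omega

/-- If `z` differed from `v` at a place where `u` and `v` agree, that place would use up both
substitutions and `u` would equal `v`. -/
theorem Near.eq_or_flip {z u v : ℤ → Bool} (hu : Near z u) (hv : Near z v)
    (hne : ∃ m, u m ≠ v m) : z = v ∨ ∃ p, u p ≠ v p ∧ z = flip v p := by
  obtain ⟨p, hp⟩ := hv
  by_cases hz : z p = v p
  · left
    funext m
    by_cases hm : m = p
    · rw [hm, hz]
    · exact hp m hm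
  · right
    have hflip : z = flip v p := by
      funext m
      by_cases hm : m = p
      · subst hm
        simp only [flip, if_true]
        revert hz
        cases z m <;> cases v m <;> simp
      · simp [flip, hm, hp m hm]
    refine ⟨p, fun hup => ?_, hflip⟩
    obtain ⟨r, hr⟩ := hu
    obtain ⟨m, hm⟩ := hne
    have hrp : p = r := by
      by_contra h
      exact hz ((hr p h).trans hup)
    subst hrp
    have hmp : m ≠ p := fun h => hm (h ▸ hup)
    exact hm ((hr m hmp).symm.trans (hp m hmp))

theorem Near.eq_flip {z u v : ℤ → Bool} (hu : Near z u) (hv : Near z v) {a b : ℤ} (hab : a ≠ b)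
    (ha : u a ≠ v a) (hb : u b ≠ v b) : z = flip v a ∨ z = flip v b := by
  rcases hu.eq_or_flip hv ⟨a, ha⟩ with rfl | ⟨p, hp, h⟩
  · obtain ⟨p, hp⟩ := hu
    have h1 : a = p := by
      by_contra h
      exact ha (hp a h).symm
    have h2 : b = p := by
      by_contra h
      exact hb (hp b h).symm
    omega
  · by_cases h1 : p = a
    · exact Or.inl (h1 ▸ h)
    · by_cases h2 : p = b
      · exact Or.inr (h2 ▸ h)
      · exact (hu.not_three hv hp ha hb h1 h2 hab).elim

/-! ### Moment identities -/

theorem sum_Ico_split (g : ℤ → ℤ) {a b c : ℤ} (hab : a ≤ b) (hbc : b ≤ c) :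
    ∑ m ∈ Finset.Ico a c, g m = ∑ m ∈ Finset.Ico a b, g m + ∑ m ∈ Finset.Ico b c, g m := by
  rw [← Finset.Ico_union_Ico_eq_Ico hab hbc,
    Finset.sum_union (Finset.Ico_disjoint_Ico_consecutive a b c)]

theorem sum_Ico_succ (g : ℤ → ℤ) (a b : ℤ) :
    ∑ m ∈ Finset.Ico (a + 1) (b + 1), g m = ∑ m ∈ Finset.Ico a b, g (m + 1) :=
  (Finset.sum_Ico_add' g a b 1).symm

theorem sum_Ico_singleton (g : ℤ → ℤ) (a : ℤ) : ∑ m ∈ Finset.Ico a (a + 1), g m = g a := by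
  have : Finset.Ico a (a + 1) = {a} := by ext; simp; omega
  simp [this]

/-- Regroups a sum along the alignment with deletions at `i` and `j`: the two deleted terms are set
apart, and between them position m + 1 of the first word faces position m of the second. -/
theorem sum_sub_shift (g h : ℤ → ℤ) {f i j l : ℤ} (hfi : f ≤ i) (hij : i ≤ j) (hjl : j ≤ l) :
    ∑ m ∈ Finset.Icc f l, (g m - h m) =
      ∑ m ∈ Finset.Ico f i, (g m - h m) + (g i - h j) +
        ∑ m ∈ Finset.Ico i j, (g (m + 1) - h m) + ∑ m ∈ Finset.Ico (j + 1) (l + 1), (g m - h m) := by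
  have e : Finset.Icc f l = Finset.Ico f (l + 1) := by ext; simp
  rw [e, Finset.sum_sub_distrib, Finset.sum_sub_distrib, Finset.sum_sub_distrib,
    Finset.sum_sub_distrib]
  rw [sum_Ico_split g hfi (by omega : i ≤ l + 1), sum_Ico_split g (by omega : i ≤ i + 1)
    (by omega : i + 1 ≤ l + 1), sum_Ico_split g (by omega : i + 1 ≤ j + 1)
    (by omega : j + 1 ≤ l + 1), sum_Ico_split h hfi (by omega : i ≤ l + 1),
    sum_Ico_split h hij (by omega : j ≤ l + 1), sum_Ico_split h (by omega : j ≤ j + 1)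
    (by omega : j + 1 ≤ l + 1), sum_Ico_singleton, sum_Ico_singleton, sum_Ico_succ g i j]
  ring

theorem sum_val_nonneg (x : ℤ → Bool) (i j : ℤ) :
    0 ≤ ∑ m ∈ Finset.Ico i j, val x (m + 1) :=
  Finset.sum_nonneg fun m _ => val_nonneg x (m + 1)

theorem sum_val_le (x : ℤ → Bool) {i j : ℤ} (hij : i ≤ j) :
    ∑ m ∈ Finset.Ico i j, val x (m + 1) ≤ j - i := by
  calc _ ≤ ∑ m ∈ Finset.Ico i j, (1 : ℤ) := Finset.sum_le_sum fun m _ => val_le_one x (m + 1)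
    _ = j - i := by simp [hij]

theorem sum_eq_of_unique (g : ℤ → ℤ) {s : Finset ℤ} {a : ℤ} (ha : a ∈ s)
    (h : ∀ m ∈ s, m ≠ a → g m = 0) : ∑ m ∈ s, g m = g a :=
  Finset.sum_eq_single a h (fun h' => (h' ha).elim)

namespace Config

variable {x y : ℤ → Bool} {f f₂ l₂ l : ℤ}

theorem symm (C : Config x y f f₂ l₂ l) : Config y x f f₂ l₂ l where
  lt_first := C.lt_first
  lt_mid := C.lt_mid
  lt_last := C.lt_last
  ne_f := C.ne_f.symm
  ne_f₂ := C.ne_f₂.symm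
  ne_l₂ := C.ne_l₂.symm
  ne_l := C.ne_l.symm
  before m h := (C.before m h).symm
  gap_first m h h' := (C.gap_first m h h').symm
  gap_last m h h' := (C.gap_last m h h').symm
  after m h := (C.after m h).symm
  sum_zero := by
    have := C.sum_zero
    rw [Finset.sum_sub_distrib] at this ⊢
    linarith
  sum_one := by
    have := C.sum_one
    rw [Finset.sum_sub_distrib] at this ⊢
    linarith

theorem sum_Icc_neg (g : ℤ → ℤ) (a b : ℤ) :
    ∑ m ∈ Finset.Icc (-b) (-a), g m = ∑ m ∈ Finset.Icc a b, g (-m) := by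
  refine Finset.sum_bij' (fun m _ => -m) (fun m _ => -m) ?_ ?_ ?_ ?_ ?_ <;> simp <;> omega

theorem reverse (C : Config x y f f₂ l₂ l) :
    Config (rev y) (rev x) (-l) (-l₂) (-f₂) (-f) where
  lt_first := by have := C.lt_last; omega
  lt_mid := by have := C.lt_mid; omega
  lt_last := by have := C.lt_first; omega
  ne_f := by simpa [rev] using C.ne_l.symm
  ne_f₂ := by simpa [rev] using C.ne_l₂.symm
  ne_l₂ := by simpa [rev] using C.ne_f₂.symm
  ne_l := by simpa [rev] using C.ne_f.symm
  before m h := (C.after (-m) (by omega)).symm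
  gap_first m h h' := (C.gap_last (-m) (by omega) (by omega)).symm
  gap_last m h h' := (C.gap_first (-m) (by omega) (by omega)).symm
  after m h := (C.before (-m) (by omega)).symm
  sum_zero := by
    rw [sum_Icc_neg]
    simpa [rev, val] using C.symm.sum_zero
  sum_one := by
    rw [sum_Icc_neg, ← C.sum_one]
    refine Finset.sum_congr rfl fun m _ => ?_
    simp only [rev, val, neg_neg]
    ring

/-- Of the part before `i` only the difference at `f` remains. In the first moment, the shift by one
produces the extra weight of `x` on the shifted stretch, which lies between 0 and j - i; this is the
source of all contradictions and estimates below. -/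
theorem moments (C : Config x y f f₂ l₂ l) {i j : ℤ} (hfi : f < i) (hif : i ≤ f₂) (hij : i ≤ j)
    (hjl : j ≤ l) :
    val x f - val y f + (val x i - val y j) + ∑ m ∈ Finset.Ico i j, (val x (m + 1) - val y m) +
        ∑ m ∈ Finset.Ico (j + 1) (l + 1), (val x m - val y m) = 0 ∧
      f * (val x f - val y f) + (i * val x i - j * val y j) +
        ∑ m ∈ Finset.Ico i j, m * (val x (m + 1) - val y m) +
        ∑ m ∈ Finset.Ico i j, val x (m + 1) +
        ∑ m ∈ Finset.Ico (j + 1) (l + 1), (m * val x m - m * val y m) = 0 := by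
  have h0 := sum_sub_shift (val x) (val y) hfi.le hij hjl
  have h1 := sum_sub_shift (fun m => m * val x m) (fun m => m * val y m) hfi.le hij hjl
  rw [C.sum_zero] at h0
  rw [C.sum_one] at h1
  have hmem : f ∈ Finset.Ico f i := by simp [hfi]
  have heq : ∀ m ∈ Finset.Ico f i, m ≠ f → val x m = val y m := fun m hm hmf => by
    rw [Finset.mem_Ico] at hm
    exact val_congr (C.gap_first m (by omega) (by omega))
  rw [sum_eq_of_unique _ hmem (fun m hm hmf => by rw [heq m hm hmf, sub_self])] at h0
  rw [sum_eq_of_unique _ hmem (fun m hm hmf => by rw [heq m hm hmf, sub_self])] at h1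
  have h2 : ∑ m ∈ Finset.Ico i j, ((m + 1) * val x (m + 1) - m * val y m) =
      ∑ m ∈ Finset.Ico i j, m * (val x (m + 1) - val y m) +
        ∑ m ∈ Finset.Ico i j, val x (m + 1) := by
    rw [← Finset.sum_add_distrib]
    exact Finset.sum_congr rfl fun m _ => by ring
  rw [h2] at h1
  constructor
  · linarith
  · linarith

/-- The shift of `x` against `y` cannot be exact from the second difference to the last. -/
theorem exists_mismatch (C : Config x y f f₂ l₂ l) : ∃ q, f₂ ≤ q ∧ q < l ∧ x (q + 1) ≠ y q := by
  by_contra! h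
  have h1 := C.lt_first
  have h2 := C.lt_mid
  have h3 := C.lt_last
  obtain ⟨h0, h1⟩ := C.moments C.lt_first le_rfl (by omega : f₂ ≤ l) le_rfl
  have hz : ∀ m ∈ Finset.Ico f₂ l, val x (m + 1) - val y m = 0 := fun m hm => by
    rw [Finset.mem_Ico] at hm
    rw [val_congr (h m hm.1 hm.2), sub_self]
  rw [Finset.sum_eq_zero hz, Finset.Ico_self, Finset.sum_empty] at h0
  rw [Finset.sum_eq_zero (fun m hm => by rw [hz m hm, mul_zero]), Finset.Ico_self,
    Finset.sum_empty] at h1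
  have h4 := sum_val_nonneg x f₂ l
  have h5 := sum_val_le x (by omega : f₂ ≤ l)
  have h6 := val_sub_of_ne C.ne_f
  -- Order 0 fixes `x f₂` and `y l` from the sign at `f`; then order 1 reads f₂ - f + weight = 0 or
  -- weight = l - f, and both fail as 0 ≤ weight ≤ l - f₂.
  rcases val_eq_zero_or_one x f₂ with h7 | h7 <;> rcases val_eq_zero_or_one y l with h8 | h8 <;>
    rcases h6 with h6 | h6 <;> rw [h6, h7, h8] at h0 h1 <;> linarith

theorem exists_mismatch_inner (C : Config x y f f₂ l₂ l) :
    ∃ q, f₂ ≤ q ∧ q < l₂ ∧ x (q + 1) ≠ y q := by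
  by_contra! h
  have h1 := C.lt_first
  have h2 := C.lt_mid
  have h3 := C.lt_last
  obtain ⟨h0, h1⟩ := C.moments C.lt_first le_rfl h2.le h3.le
  have hz : ∀ m ∈ Finset.Ico f₂ l₂, val x (m + 1) - val y m = 0 := fun m hm => by
    rw [Finset.mem_Ico] at hm
    rw [val_congr (h m hm.1 hm.2), sub_self]
  have hmem : l ∈ Finset.Ico (l₂ + 1) (l + 1) := by simp; omega
  have heq : ∀ m ∈ Finset.Ico (l₂ + 1) (l + 1), m ≠ l → val x m = val y m := fun m hm hml => by
    rw [Finset.mem_Ico] at hm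
    exact val_congr (C.gap_last m (by omega) (by omega))
  rw [Finset.sum_eq_zero hz, sum_eq_of_unique _ hmem
    (fun m hm hmf => by rw [heq m hm hmf, sub_self])] at h0
  rw [Finset.sum_eq_zero (fun m hm => by rw [hz m hm, mul_zero]), sum_eq_of_unique _ hmem
    (fun m hm hmf => by rw [heq m hm hmf, sub_self]), ← mul_sub] at h1
  have h4 := sum_val_nonneg x f₂ l₂
  have h5 := sum_val_le x h2.le
  have h6 := val_sub_of_ne C.ne_f
  have h9 := val_sub_of_ne C.ne_l
  rcases val_eq_zero_or_one x f₂ with h7 | h7 <;> rcases val_eq_zero_or_one y l₂ with h8 | h8 <;>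
    rcases h6 with h6 | h6 <;> rcases h9 with h9 | h9 <;> rw [h6, h7, h8, h9] at h0 h1 <;> linarith

/-- With a single mismatch in the shift, the first moment balances the distance from `f` to `q`
against a weight of at most l - f₂. This controls the gap f₂ - f, about which the alignments say
nothing. -/
theorem mismatch_sub_le (C : Config x y f f₂ l₂ l) {q : ℤ} (hfq : f₂ ≤ q) (hql : q < l)
    (hq : x (q + 1) ≠ y q) (huniq : ∀ m, f₂ ≤ m → m < l → m ≠ q → x (m + 1) = y m) :
    q - f ≤ l - f₂ := by
  have h1 := C.lt_first
  have h2 := C.lt_mid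
  have h3 := C.lt_last
  obtain ⟨h0, h1⟩ := C.moments C.lt_first le_rfl (by omega : f₂ ≤ l) le_rfl
  have hmem : q ∈ Finset.Ico f₂ l := by simp; omega
  have heq : ∀ m ∈ Finset.Ico f₂ l, m ≠ q → val x (m + 1) - val y m = 0 := fun m hm hml => by
    rw [Finset.mem_Ico] at hm
    rw [val_congr (huniq m hm.1 hm.2 hml), sub_self]
  rw [sum_eq_of_unique _ hmem heq, Finset.Ico_self, Finset.sum_empty] at h0
  rw [sum_eq_of_unique (fun m => m * (val x (m + 1) - val y m)) hmem
    (fun m hm hmf => by rw [heq m hm hmf, mul_zero]), Finset.Ico_self,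
    Finset.sum_empty] at h1
  have h4 := sum_val_nonneg x f₂ l
  have h5 := sum_val_le x (by omega : f₂ ≤ l)
  have h6 := val_sub_of_ne C.ne_f
  have h9 := val_sub_of_ne hq
  rcases val_eq_zero_or_one x f₂ with h7 | h7 <;> rcases val_eq_zero_or_one y l with h8 | h8 <;>
    rcases h6 with h6 | h6 <;> rcases h9 with h9 | h9 <;> rw [h6, h7, h8, h9] at h0 h1 <;> linarith

end Config

/-! ### Alignments -/

section Mismatch

variable {x y : ℤ → Bool} {i j m : ℤ}

theorem mismatch_pre (hij : i ≤ j) (hm : m < i) : del i x m ≠ del j y m ↔ x m ≠ y m := by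
  rw [del_of_lt x hm, del_of_lt y (by omega)]

theorem mismatch_mid (hi : i ≤ m) (hj : m < j) : del i x m ≠ del j y m ↔ x (m + 1) ≠ y m := by
  rw [del_of_le x hi, del_of_lt y hj]

theorem mismatch_suf (hij : i ≤ j) (hm : j < m) :
    del i x (m - 1) ≠ del j y (m - 1) ↔ x m ≠ y m := by
  rw [del_of_le x (by omega), del_of_le y (by omega), sub_add_cancel]

end Mismatch

/-- The mirror image of a word after a deletion. -/
def revDel (z : ℤ → Bool) : ℤ → Bool := fun m => z (-m - 1)

theorem revDel_revDel (z : ℤ → Bool) : revDel (revDel z) = z := by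
  funext m
  simp only [revDel]
  congr 1
  ring

theorem revDel_del (i : ℤ) (x : ℤ → Bool) : revDel (del i x) = del (-i) (rev x) := by
  funext m
  by_cases h : m < -i
  · rw [del_of_lt _ h, revDel, del_of_le x (by omega), rev]
    congr 1
    ring
  · rw [del_of_le _ (by omega), revDel, del_of_lt x (by omega), rev]
    congr 1
    ring

theorem Near.revDel {u v : ℤ → Bool} (h : Near u v) : Near (revDel u) (revDel v) := by
  obtain ⟨p, hp⟩ := h
  exact ⟨-p - 1, fun m hm => hp _ (by omega)⟩

theorem Near.reverse {z x : ℤ → Bool} {i : ℤ} (h : Near z (del i x)) :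
    Near (Recon.revDel z) (del (-i) (rev x)) := by
  rw [← revDel_del]
  exact h.revDel

theorem Aperiodic.reverse {t : ℤ} {x : ℤ → Bool} {f l : ℤ} (h : Aperiodic t x f l) :
    Aperiodic t (rev x) (-l) (-f) := by
  intro a ha hat
  obtain ⟨k, hk1, hk2, hk⟩ := h (-a - t) (by omega) (by omega)
  refine ⟨-k - 2, by omega, by omega, ?_⟩
  simp only [rev]
  rw [show -(-k - 2) = k + 2 by ring, show -(-k - 2 + 2) = k by ring]
  exact hk.symm

namespace Config

variable {x y z : ℤ → Bool} {f f₂ l₂ l i j : ℤ}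

/-- The positions must not depend on `z` or `i`. If f₂ < i the two mismatches are `f` and `f₂`; if f
< i ≤ f₂ they are `f` and a shift mismatch `q`; if i ≤ f they are `q` and at most one further
position `e`. -/
theorem exists_positions (C : Config x y f f₂ l₂ l) :
    ∃ q e, ∀ z i, i ≤ l → Near z (del i x) → Near z (del l y) →
      (∃ m, del i x m ≠ del l y m) ∧
      ∀ p, del i x p ≠ del l y p → p = f ∨ p = f₂ ∨ p = q ∨ p = e := by
  have h1 := C.lt_first
  have h2 := C.lt_mid
  have h3 := C.lt_last
  obtain ⟨q, hfq, hql, hq⟩ := C.exists_mismatch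
  suffices H : ∃ e, ∀ z i, i ≤ f → Near z (del i x) → Near z (del l y) →
      ∀ p, del i x p ≠ del l y p → p = q ∨ p = e by
    obtain ⟨e, he⟩ := H
    refine ⟨q, e, fun z i hil hu hv => ?_⟩
    rcases le_or_gt i f with hif | hif
    · exact ⟨⟨q, (mismatch_mid (by omega) hql).2 hq⟩,
        fun p hp => Or.inr (Or.inr (he z i hif hu hv p hp))⟩
    · have hf := (mismatch_pre hil hif).2 C.ne_f
      refine ⟨⟨f, hf⟩, fun p hp => ?_⟩
      by_contra! hne
      rcases le_or_gt i f₂ with hif₂ | hif₂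
      · exact hu.not_three hv hp hf ((mismatch_mid (by omega) hql).2 hq) hne.1 hne.2.2.1 (by omega)
      · exact hu.not_three hv hp hf ((mismatch_pre hil hif₂).2 C.ne_f₂) hne.1 hne.2.1 (by omega)
  have hrange : ∀ i p, i ≤ f → del i x p ≠ del l y p →
      i ≤ p ∧ p < l ∧ x (p + 1) ≠ y p := by
    intro i p hif hp
    rcases lt_or_ge p i with h | h
    · exact ((mismatch_pre (by omega) h).1 hp (C.before p (by omega))).elim
    · rcases lt_or_ge p l with h' | h'
      · exact ⟨h, h', (mismatch_mid h h').1 hp⟩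
      · rw [del_of_le x h, del_of_le y h'] at hp
        exact (hp (C.after _ (by omega))).elim
  -- A second shift mismatch `r` in [f, l) is present for every i ≤ f and serves as `e`. Otherwise
  -- the other mismatch lies to the left of `f`, where `x` and `y` agree, so it is a run boundary of
  -- `x`.
  by_cases hr : ∃ r, f ≤ r ∧ r < l ∧ r ≠ q ∧ x (r + 1) ≠ y r
  · obtain ⟨r, hfr, hrl, hrq, hr⟩ := hr
    refine ⟨r, fun z i hif hu hv p hp => ?_⟩
    by_contra! hne
    exact hu.not_three hv hp ((mismatch_mid (by omega) hql).2 hq)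
      ((mismatch_mid (by omega) hrl).2 hr) hne.1 hne.2 hrq.symm
  push Not at hr
  have hrun : ∀ z i, i ≤ f → Near z (del i x) → Near z (del l y) → ∀ p, del i x p ≠ del l y p →
      p ≠ q → p < f ∧ x p ≠ x (p + 1) ∧ ∀ m, p < m → m < f → x m = x (m + 1) := by
    intro z i hif hu hv p hp hpq
    obtain ⟨hip, hpl, hxy⟩ := hrange i p hif hp
    have hpf : p < f := by
      by_contra h
      exact hxy (hr p (by omega) hpl hpq)
    refine ⟨hpf, ?_, fun m hpm hmf => ?_⟩
    · rw [C.before p hpf]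
      exact hxy.symm
    · by_contra hne
      rw [C.before m hmf] at hne
      exact hu.not_three hv hp ((mismatch_mid (by omega) hql).2 hq)
        ((mismatch_mid (by omega) (by omega)).2 (Ne.symm hne)) hpq (by omega) (by omega)
  -- Only the last run boundary before `f` can occur, since any boundary between a mismatch and `f`
  -- would be a third mismatch. It depends on `x` alone.
  by_cases he : ∃ e, e < f ∧ x e ≠ x (e + 1) ∧ ∀ m, e < m → m < f → x m = x (m + 1)
  · obtain ⟨e, hef, hne, hconst⟩ := he
    refine ⟨e, fun z i hif hu hv p hp => ?_⟩
    by_contra! hpe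
    obtain ⟨hpf, hpne, hpconst⟩ := hrun z i hif hu hv p hp hpe.1
    rcases lt_or_gt_of_ne hpe.2 with h | h
    · exact hne (hpconst e h hef)
    · exact hpne (hconst p h hpf)
  · refine ⟨q, fun z i hif hu hv p hp => ?_⟩
    by_contra! hpe
    exact he ⟨p, hrun z i hif hu hv p hp hpe.1⟩

/-- The words reached with the deletion in `y` at the last difference. -/
def anchored (x y : ℤ → Bool) (l : ℤ) : Set (ℤ → Bool) :=
  {z | ∃ i, i ≤ l ∧ Near z (del i x) ∧ Near z (del l y)}

theorem encard_anchored_le (C : Config x y f f₂ l₂ l) : (anchored x y l).encard ≤ 5 := by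
  classical
  obtain ⟨q, e, h⟩ := C.exists_positions
  let v := del l y
  have hsub : anchored x y l ⊆
      (({v, flip v f, flip v f₂, flip v q, flip v e} : Finset (ℤ → Bool)) : Set (ℤ → Bool)) := by
    rintro z ⟨i, hil, hu, hv⟩
    obtain ⟨hne, hp⟩ := h z i hil hu hv
    simp only [Finset.coe_insert, Finset.coe_singleton, Set.mem_insert_iff,
      Set.mem_singleton_iff]
    rcases hu.eq_or_flip hv hne with hz | ⟨p, hpne, hz⟩
    · exact Or.inl hz
    · rcases hp p hpne with rfl | rfl | rfl | rfl <;> simp [v, hz]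
  refine (Set.encard_le_encard hsub).trans ?_
  rw [Set.encard_coe_eq_coe_finsetCard]
  exact_mod_cast Finset.card_le_five

/-- Otherwise `f` and `l` both survive as mismatches, and a third comes from `f₂`, from `l₂`, or
from the shift between them. -/
theorem le_or_le_of_forward (C : Config x y f f₂ l₂ l) (hij : i ≤ j) (hu : Near z (del i x))
    (hv : Near z (del j y)) : i ≤ f ∨ l ≤ j := by
  by_contra! h
  have h3 := C.lt_last
  have hf := (mismatch_pre hij h.1).2 C.ne_f
  have hl := (mismatch_suf hij h.2).2 C.ne_l
  rcases lt_or_ge f₂ i with hi | hi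
  · have := C.lt_first
    exact hu.not_three hv hf ((mismatch_pre hij hi).2 C.ne_f₂) hl (by omega) (by omega) (by omega)
  rcases lt_or_ge j l₂ with hj | hj
  · exact hu.not_three hv hf ((mismatch_suf hij hj).2 C.ne_l₂) hl (by omega) (by omega) (by omega)
  obtain ⟨q, hq1, hq2, hq⟩ := C.exists_mismatch_inner
  exact hu.not_three hv hf ((mismatch_mid (by omega) (by omega)).2 hq) hl
    (by omega) (by omega) (by omega)

/-- Two mismatches already occur up to `l`, so `y` must be constant from `l` to `j`, and deletions
within one run give the same word. -/
theorem forward_right (C : Config x y f f₂ l₂ l) (hij : i ≤ j) (hu : Near z (del i x))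
    (hv : Near z (del j y)) (hi : f < i) (hj : l ≤ j) : i ≤ l ∧ del l y = del j y := by
  have h1 := C.lt_first
  have h2 := C.lt_mid
  have h3 := C.lt_last
  have hf := (mismatch_pre hij hi).2 C.ne_f
  have hil : i ≤ l := by
    by_contra! h
    exact hu.not_three hv hf ((mismatch_pre hij (by omega)).2 C.ne_f₂)
      ((mismatch_pre hij (by omega)).2 C.ne_l) (by omega) (by omega) (by omega)
  refine ⟨hil, del_eq_del hj fun m hlm hmj => ?_⟩
  by_contra hne
  rw [← C.after (m + 1) (by omega)] at hne
  have hm := (mismatch_mid (by omega : i ≤ m) hmj).2 (Ne.symm hne)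
  rcases le_or_gt i f₂ with hi2 | hi2
  · obtain ⟨q, hq1, hq2, hq⟩ := C.exists_mismatch
    exact hu.not_three hv hf ((mismatch_mid (by omega) (by omega)).2 hq) hm
      (by omega) (by omega) (by omega)
  · exact hu.not_three hv hf ((mismatch_pre hij hi2).2 C.ne_f₂) hm (by omega) (by omega) (by omega)

theorem anchored_of_forward (C : Config x y f f₂ l₂ l) (hij : i ≤ j) (hu : Near z (del i x))
    (hv : Near z (del j y)) (hi : f < i) : z ∈ anchored x y l := by
  rcases C.le_or_le_of_forward hij hu hv with h | hj
  · omega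
  obtain ⟨hil, heq⟩ := C.forward_right hij hu hv hi hj
  exact ⟨i, hil, hu, heq ▸ hv⟩

/-- When i ≤ f and l ≤ j, the mismatch `q` leaves room for only one more. So `y` is constant on [l,
j] or `x` is constant on [i, f], and the corresponding deletion moves to `l` or to `f`. -/
theorem forward_subset (C : Config x y f f₂ l₂ l) :
    forwardSet x y ⊆ anchored x y l ∪ revDel '' anchored (rev y) (rev x) (-f) := by
  have h1 := C.lt_first
  have h2 := C.lt_mid
  have h3 := C.lt_last
  rintro z ⟨i, j, hij, hu, hv⟩
  rcases lt_or_ge f i with hi | hi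
  · exact Or.inl (C.anchored_of_forward hij hu hv hi)
  rcases lt_or_ge j l with hj | hj
  · exact Or.inr ⟨revDel z, C.reverse.anchored_of_forward (by omega) hv.reverse hu.reverse
      (by omega), revDel_revDel z⟩
  obtain ⟨q, hq1, hq2, hq⟩ := C.exists_mismatch
  have hqm := (mismatch_mid (by omega : i ≤ q) (by omega : q < j)).2 hq
  by_cases hm : ∃ m, l ≤ m ∧ m < j ∧ y m ≠ y (m + 1)
  · right
    obtain ⟨m, hlm, hmj, hm⟩ := hm
    rw [← C.after (m + 1) (by omega)] at hm
    have hmm := (mismatch_mid (by omega : i ≤ m) hmj).2 hm.symm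
    have heq : del i x = del f x := del_eq_del hi fun k hik hkf => by
      by_contra hne
      rw [C.before k hkf] at hne
      exact hu.not_three hv hqm hmm ((mismatch_mid hik (by omega)).2 (Ne.symm hne))
        (by omega) (by omega) (by omega)
    rw [heq] at hu
    exact ⟨revDel z, ⟨-j, by omega, hv.reverse, hu.reverse⟩, revDel_revDel z⟩
  · left
    push Not at hm
    exact ⟨i, by omega, hu, (del_eq_del hj hm) ▸ hv⟩

theorem encard_forwardSet_le (C : Config x y f f₂ l₂ l) : (forwardSet x y).encard ≤ 10 := by
  calc (forwardSet x y).encard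
      ≤ (anchored x y l ∪ revDel '' anchored (rev y) (rev x) (-f)).encard :=
        Set.encard_le_encard C.forward_subset
    _ ≤ (anchored x y l).encard + (revDel '' anchored (rev y) (rev x) (-f)).encard :=
        Set.encard_union_le _ _
    _ ≤ 5 + 5 := add_le_add C.encard_anchored_le
        ((Set.encard_image_le _ _).trans C.reverse.encard_anchored_le)
    _ = 10 := by norm_num

end Config

/-! ### Widely separated differences -/

/-- Few points cannot block all windows of length `t` in a long interval: discard the first window
together with a point it contains, and induct. -/
theorem le_of_forall_interval_meets {t : ℤ} (ht : 0 < t) (B : ℤ) :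
    ∀ (N : ℕ) (E : Finset ℤ) (A : ℤ), E.card ≤ N →
      (∀ c, A < c → c + t ≤ B → ∃ m ∈ E, c ≤ m ∧ m < c + t) → B - A ≤ (N + 1) * t := by
  intro N
  induction N with
  | zero =>
    intro E A hE h
    by_contra! hlt
    obtain ⟨m, hm, -⟩ := h (A + 1) (by omega) (by push_cast at hlt; linarith)
    rw [Finset.card_eq_zero.1 (Nat.le_zero.1 hE)] at hm
    simp at hm
  | succ N ih =>
    intro E A hE h
    by_cases hB : B - A ≤ t
    · push_cast
      nlinarith [mul_nonneg (Int.natCast_nonneg N) ht.le]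
    obtain ⟨m, hm, hm1, hm2⟩ := h (A + 1) (by omega) (by omega)
    have hcard : (E.erase m).card ≤ N := by
      rw [Finset.card_erase_of_mem hm]
      omega
    have := ih (E.erase m) (A + t) hcard fun c hc hcB => by
      obtain ⟨k, hk, hk1, hk2⟩ := h c (by omega) hcB
      exact ⟨k, Finset.mem_erase.2 ⟨by omega, hk⟩, hk1, hk2⟩
    push_cast
    linarith

theorem Aperiodic.not_run {t : ℤ} {x y : ℤ → Bool} {f l c : ℤ} (h : Aperiodic t x f l)
    (hc : f ≤ c) (hcl : c + t ≤ l) (hs : ∀ m, c ≤ m → m < c + t → x (m + 1) = y m)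
    (he : ∀ m, c ≤ m → m < c + t → x m = y m) : False := by
  obtain ⟨k, hk1, hk2, hk⟩ := h c hc hcl
  apply hk
  rw [he k hk1 (by omega), ← hs k hk1 (by omega), he (k + 1) (by omega) (by omega),
    ← hs (k + 1) (by omega) (by omega)]
  congr 1
  ring

/-- Two opposite shifts compose to period 2, just as a shift and an equality give period 1 in
`Aperiodic.not_run`. -/
theorem Aperiodic.not_alternating {t : ℤ} {x y : ℤ → Bool} {f l c : ℤ} (h : Aperiodic t x f l)
    (hc : f ≤ c) (hcl : c + t ≤ l) (hs : ∀ m, c ≤ m → m < c + t → x (m + 1) = y m)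
    (he : ∀ m, c ≤ m → m < c + t → y (m + 1) = x m) : False := by
  obtain ⟨k, hk1, hk2, hk⟩ := h c hc hcl
  apply hk
  rw [← he k hk1 (by omega), ← hs (k + 1) (by omega) (by omega)]
  congr 1
  ring

/-- Outside a small set of positions, an alignment is locally a pure identity or a pure shift. -/
theorem exists_cuts {x y : ℤ → Bool} {i j A l t : ℤ} (ht : 0 < t) (hij : i ≤ j)
    (hA : x A ≠ y A) (hl : x l ≠ y l) (D : Finset ℤ)
    (hD : ∀ m, A ≤ m → del i x m ≠ del j y m → m ∈ D) :
    ∃ E : Finset ℤ, E.card ≤ D.card ∧ ∀ c, A < c → c + t ≤ l →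
      (∀ m ∈ E, ¬ (c ≤ m ∧ m < c + t)) →
      (c + t ≤ i ∧ ∀ m, c ≤ m → m < c + t → x m = y m) ∨
      (i ≤ c ∧ c + t ≤ j ∧ ∀ m, c ≤ m → m < c + t → x (m + 1) = y m) ∨
      (j < c ∧ ∀ m, c ≤ m → m < c + t → x m = y m) := by
  classical
  -- Besides the mismatches, windows must avoid the borders `i` and `j`, yet `E` may not outgrow
  -- `D`. The mismatches at `A` and `l` lie outside every window, so their places are reused to mark
  -- the borders. After `j` the index in the shortened word is one less than the position, hence m +
  -- 1.
  let φ : ℤ → ℤ := fun m =>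
    if m = A ∧ A < i then i else if m = l - 1 ∧ j ≤ m then j else if m < j then m else m + 1
  refine ⟨D.image φ, Finset.card_image_le, fun c hc hcl hE => ?_⟩
  have hφ : ∀ m, A ≤ m → del i x m ≠ del j y m → ¬ (c ≤ φ m ∧ φ m < c + t) :=
    fun m hm hne => hE _ (Finset.mem_image_of_mem _ (hD m hm hne))
  have hi : ¬ (c ≤ i ∧ i < c + t) ∨ i ≤ c := by
    rcases lt_or_ge A i with h | h
    · left
      have := hφ A le_rfl ((mismatch_pre hij h).2 hA)
      simpa [φ, h] using this
    · right; omega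
  have hj : ¬ (c ≤ j ∧ j < c + t) := by
    rcases lt_or_ge j l with h | h
    · rcases lt_or_ge (l - 1) A with h' | h'
      · omega
      have := hφ (l - 1) h' ((mismatch_suf hij h).2 hl)
      have e : φ (l - 1) = j := by
        simp only [φ, true_and]
        split_ifs <;> omega
      rwa [e] at this
    · omega
  rcases lt_or_ge c i with hci | hci
  · left
    refine ⟨by omega, fun m hm1 hm2 => ?_⟩
    by_contra hne
    have := hφ m (by omega) ((mismatch_pre hij (by omega)).2 hne)
    have e : φ m = m := by
      simp only [φ]
      rw [if_neg (by omega), if_neg (by omega), if_pos (by omega)]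
    rw [e] at this
    omega
  rcases lt_or_ge j c with hcj | hcj
  · right; right
    refine ⟨hcj, fun m hm1 hm2 => ?_⟩
    by_contra hne
    have := hφ (m - 1) (by omega) ((mismatch_suf hij (by omega)).2 hne)
    have e : φ (m - 1) = m := by
      simp only [φ]
      rw [if_neg (by omega), if_neg (by omega), if_neg (by omega)]
      ring
    rw [e] at this
    omega
  · right; left
    refine ⟨hci, by omega, fun m hm1 hm2 => ?_⟩
    by_contra hne
    have := hφ m (by omega) ((mismatch_mid (by omega) (by omega)).2 hne)
    have e : φ m = m := by
      simp only [φ]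
      rw [if_neg (by omega), if_neg (by omega), if_pos (by omega)]
    rw [e] at this
    omega

theorem Near.exists_mismatch_finset {z u v : ℤ → Bool} (hu : Near z u) (hv : Near z v) :
    ∃ D : Finset ℤ, D.card ≤ 2 ∧ ∀ m, u m ≠ v m → m ∈ D := by
  obtain ⟨p, q, h⟩ := hu.two_points hv
  exact ⟨{p, q}, Finset.card_le_two, fun m hm => by simpa using h m hm⟩

namespace Config

variable {x y z z' : ℤ → Bool} {f f₂ l₂ l i j i' j' t : ℤ}

/-- A forward alignment that is a shift from `f₂` to `l` cannot coexist with any backward one: a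
window free of exceptions would carry a shift together with an equality or the opposite shift. -/
theorem not_forward_right_of_long (C : Config x y f f₂ l₂ l) (ht : 0 < t)
    (hx : Aperiodic t x f l) (hy : Aperiodic t y f l) (hlong : 6 * t < l - f)
    (hij : i ≤ j) (hu : Near z (del i x)) (hv : Near z (del j y))
    (hij' : j' ≤ i') (hu' : Near z' (del j' y)) (hv' : Near z' (del i' x))
    (hi : i ≤ f₂) (hj : l ≤ j) : False := by
  classical
  have h1 := C.lt_first
  have h2 := C.lt_mid
  have h3 := C.lt_last
  have hi' : f₂ ≤ i' := by
    by_contra! h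
    exact hu'.not_three hv' ((mismatch_suf hij' h).2 C.ne_f₂.symm)
      ((mismatch_suf hij' (by omega)).2 C.ne_l₂.symm)
      ((mismatch_suf hij' (by omega)).2 C.ne_l.symm) (by omega) (by omega) (by omega)
  obtain ⟨D', hD'card, hD'⟩ := hu'.exists_mismatch_finset hv'
  by_cases hcase : i ≤ f ∨ j' ≤ f
  · obtain ⟨D, hDcard, hD⟩ := hu.exists_mismatch_finset hv
    obtain ⟨E, hE, hcut⟩ := exists_cuts ht hij C.ne_f C.ne_l D fun m _ => hD m
    obtain ⟨E', hE', hcut'⟩ := exists_cuts ht hij' C.ne_f.symm C.ne_l.symm D' fun m _ => hD' m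
    have hcard : (E ∪ E').card ≤ 4 := (Finset.card_union_le _ _).trans (by omega)
    -- Each alignment has at most two exceptions, so an interval longer than 5t contains a free
    -- window. By `hcase` the two alignments are not both identities there.
    have := le_of_forall_interval_meets ht l 4 (E ∪ E') f hcard fun c hc hcl => by
      by_contra! hmeet
      rcases hcut c hc hcl (fun m hm => by
          have := hmeet m (Finset.mem_union_left _ hm); omega) with
        ⟨ha, he⟩ | ⟨ha, hb, he⟩ | ⟨ha, he⟩ <;>
      rcases hcut' c hc hcl (fun m hm => by
          have := hmeet m (Finset.mem_union_right _ hm); omega) with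
        ⟨ha', he'⟩ | ⟨ha', hb', he'⟩ | ⟨ha', he'⟩
      · omega
      · exact hy.not_run hc.le hcl he' fun m h h' => (he m h h').symm
      · omega
      · exact hx.not_run hc.le hcl he fun m h h' => (he' m h h').symm
      · exact hx.not_alternating hc.le hcl he he'
      · exact hx.not_run hc.le hcl he fun m h h' => (he' m h h').symm
      all_goals omega
    push_cast at this
    linarith
  · push Not at hcase
    obtain ⟨hif, hj'f⟩ := hcase
    obtain ⟨q, hq1, hq2, hq⟩ := C.exists_mismatch
    have hf := (mismatch_pre hij hif).2 C.ne_f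
    have hqm := (mismatch_mid (by omega : i ≤ q) (by omega : q < j)).2 hq
    have huniq : ∀ m, f₂ ≤ m → m < l → m ≠ q → x (m + 1) = y m := fun m hm1 hm2 hmq => by
      by_contra hne
      exact hu.not_three hv hf hqm ((mismatch_mid (by omega) (by omega)).2 hne)
        (by omega) (by omega) hmq.symm
    -- To the right of `f₂` only `q` and one cut of the backward alignment remain, so l - f₂ ≤ 3t.
    -- Since f₂ ≤ q, this bound also gives f₂ - f ≤ 3t, whence the threshold 6t.
    have hq3 := C.mismatch_sub_le hq1 hq2 hq huniq
    obtain ⟨E', hE', hcut'⟩ := exists_cuts ht hij' C.ne_f₂.symm C.ne_l.symm (D'.erase f)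
      fun m hm hne => Finset.mem_erase.2 ⟨by omega, hD' m hne⟩
    rw [Finset.card_erase_of_mem (hD' f ((mismatch_pre hij' hj'f).2 C.ne_f.symm))] at hE'
    have hcard : (insert q E').card ≤ 2 := (Finset.card_insert_le _ _).trans (by omega)
    have := le_of_forall_interval_meets ht l 2 (insert q E') f₂ hcard fun c hc hcl => by
      by_contra! hmeet
      have hcq := hmeet q (Finset.mem_insert_self _ _)
      have he : ∀ m, c ≤ m → m < c + t → x (m + 1) = y m := fun m hm1 hm2 =>
        huniq m (by omega) (by omega) (by omega)
      rcases hcut' c hc hcl (fun m hm => by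
          have := hmeet m (Finset.mem_insert_of_mem hm); omega) with
        ⟨ha', he'⟩ | ⟨ha', hb', he'⟩ | ⟨ha', he'⟩
      · exact hx.not_run (by omega) hcl he fun m h h' => (he' m h h').symm
      · exact hx.not_alternating (by omega) hcl he he'
      · exact hx.not_run (by omega) hcl he fun m h h' => (he' m h h').symm
    push_cast at this
    linarith

theorem eq_flip_of_forward (C : Config x y f f₂ l₂ l) (hij : i ≤ j) (hu : Near z (del i x))
    (hv : Near z (del j y)) (hi : f₂ < i) (hj : l ≤ j) :
    z = flip (del l y) f ∨ z = flip (del l y) f₂ := by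
  have h1 := C.lt_first
  obtain ⟨-, heq⟩ := C.forward_right hij hu hv (by omega) hj
  rw [heq]
  exact hu.eq_flip hv (by omega) ((mismatch_pre hij (by omega)).2 C.ne_f)
    ((mismatch_pre hij hi).2 C.ne_f₂)

/-- Once shifts across `f₂` up to `l`, and their mirror images, are excluded, the two mismatches are
`f, f₂` or `l₂, l`, and each pair allows two words. -/
theorem encard_forwardSet_le_four (C : Config x y f f₂ l₂ l) (ht : 0 < t)
    (hx : Aperiodic t x f l) (hy : Aperiodic t y f l) (hlong : 6 * t < l - f)
    (hne : (forwardSet y x).Nonempty) : (forwardSet x y).encard ≤ 4 := by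
  classical
  have h1 := C.lt_first
  have h2 := C.lt_mid
  have h3 := C.lt_last
  obtain ⟨z', j', i', hij', hu', hv'⟩ := hne
  let v := del l y
  let w := del (-f) (rev x)
  have hsub : forwardSet x y ⊆ (({flip v f, flip v f₂, revDel (flip w (-l)),
      revDel (flip w (-l₂))} : Finset (ℤ → Bool)) : Set (ℤ → Bool)) := by
    rintro z ⟨i, j, hij, hu, hv⟩
    simp only [Finset.coe_insert, Finset.coe_singleton, Set.mem_insert_iff,
      Set.mem_singleton_iff]
    rcases C.le_or_le_of_forward hij hu hv with hi | hj
    · have hj : j < l₂ := by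
        by_contra! h
        exact C.reverse.not_forward_right_of_long ht hy.reverse hx.reverse (by omega)
          (by omega : -j ≤ -i) hv.reverse hu.reverse (by omega : -i' ≤ -j') hv'.reverse
          hu'.reverse (by omega) (by omega)
      rcases C.reverse.eq_flip_of_forward (by omega : -j ≤ -i) hv.reverse hu.reverse
        (by omega) (by omega) with h | h
      · right; right; left
        rw [← h, revDel_revDel]
      · right; right; right
        rw [← h, revDel_revDel]
    · have hi : f₂ < i := by
        by_contra! h
        exact C.not_forward_right_of_long ht hx hy hlong hij hu hv hij' hu' hv' h hj
      rcases C.eq_flip_of_forward hij hu hv hi hj with h | h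
      · exact Or.inl h
      · exact Or.inr (Or.inl h)
  refine (Set.encard_le_encard hsub).trans ?_
  rw [Set.encard_coe_eq_coe_finsetCard]
  exact_mod_cast Finset.card_le_four

theorem encard_union_le_of_long (C : Config x y f f₂ l₂ l) (ht : 0 < t)
    (hx : Aperiodic t x f l) (hy : Aperiodic t y f l) (hlong : 6 * t < l - f) :
    (forwardSet x y ∪ forwardSet y x).encard ≤ 10 := by
  rcases (forwardSet x y).eq_empty_or_nonempty with h | h
  · rw [h, Set.empty_union]
    exact C.symm.encard_forwardSet_le
  rcases (forwardSet y x).eq_empty_or_nonempty with h' | h'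
  · rw [h', Set.union_empty]
    exact C.encard_forwardSet_le
  calc (forwardSet x y ∪ forwardSet y x).encard
      ≤ (forwardSet x y).encard + (forwardSet y x).encard := Set.encard_union_le _ _
    _ ≤ 4 + 4 := add_le_add (C.encard_forwardSet_le_four ht hx hy hlong h')
        (C.symm.encard_forwardSet_le_four ht hy hx hlong h)
    _ ≤ 10 := by norm_num

end Config

/-! ### Sign pattern of the suffix sums -/

/-- The difference of the weights of `x` and `y` on `[m, n)`. -/
noncomputable def suffixDiff (x y : ℤ → Bool) (n m : ℤ) : ℤ := ∑ k ∈ Finset.Ico m n, (val x k - val y k)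

theorem suffixDiff_swap (x y : ℤ → Bool) (n m : ℤ) : suffixDiff y x n m = -suffixDiff x y n m := by
  unfold suffixDiff
  rw [← Finset.sum_neg_distrib]
  exact Finset.sum_congr rfl fun k _ => by ring

theorem suffixDiff_eq_add (x y : ℤ → Bool) {n m : ℤ} (h : m < n) :
    suffixDiff x y n m = val x m - val y m + suffixDiff x y n (m + 1) := by
  unfold suffixDiff
  rw [sum_Ico_split _ (by omega : m ≤ m + 1) (by omega : m + 1 ≤ n), sum_Ico_singleton]

theorem sum_val_of_le {x : ℤ → Bool} {n i m : ℤ} (hin : i < n) (hm : m ≤ i) :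
    ∑ k ∈ Finset.Ico m n, val x k = ∑ k ∈ Finset.Ico m (n - 1), val (del i x) k + val x i := by
  rw [sum_Ico_split _ hm (by omega : i ≤ n), sum_Ico_split _ (by omega : i ≤ i + 1)
    (by omega : i + 1 ≤ n), sum_Ico_singleton, sum_Ico_split _ hm (by omega : i ≤ n - 1),
    show n = n - 1 + 1 by ring, sum_Ico_succ, show n - 1 + 1 - 1 = n - 1 by ring]
  have e1 : ∑ k ∈ Finset.Ico m i, val (del i x) k = ∑ k ∈ Finset.Ico m i, val x k :=
    Finset.sum_congr rfl fun k hk => by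
      rw [Finset.mem_Ico] at hk
      simp only [val, del_of_lt x hk.2]
  have e2 : ∑ k ∈ Finset.Ico i (n - 1), val (del i x) k =
      ∑ k ∈ Finset.Ico i (n - 1), val x (k + 1) :=
    Finset.sum_congr rfl fun k hk => by
      rw [Finset.mem_Ico] at hk
      simp only [val, del_of_le x hk.1]
  rw [e1, e2]
  ring

theorem sum_val_of_lt {x : ℤ → Bool} {n i m : ℤ} (hm : i < m) :
    ∑ k ∈ Finset.Ico m n, val x k = ∑ k ∈ Finset.Ico (m - 1) (n - 1), val (del i x) k := by
  have h := sum_Ico_succ (val x) (m - 1) (n - 1)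
  rw [sub_add_cancel, sub_add_cancel] at h
  rw [h]
  refine Finset.sum_congr rfl fun k hk => ?_
  rw [Finset.mem_Ico] at hk
  simp only [val, del_of_le x (by omega : i ≤ k)]

theorem Near.exists_val_sub {z u : ℤ → Bool} (h : Near z u) :
    ∃ a p : ℤ, |a| ≤ 1 ∧ ∀ m, val z m - val u m = if m = p then a else 0 := by
  obtain ⟨p, hp⟩ := h
  refine ⟨val z p - val u p, p, ?_, fun m => ?_⟩
  · have := val_nonneg z p
    have := val_nonneg u p
    have := val_le_one z p
    have := val_le_one u p
    rw [abs_le]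
    omega
  · split_ifs with hm
    · rw [hm]
    · rw [val_congr (hp m hm), sub_self]

theorem sum_ite_Ico (a p m N : ℤ) :
    ∑ k ∈ Finset.Ico m N, (if k = p then a else 0) =
      if m ≤ p then (if p < N then a else 0) else 0 := by
  rw [Finset.sum_ite_eq']
  simp only [Finset.mem_Ico]
  split_ifs <;> first | rfl | omega

/-- The suffix sums of the difference of two words that are near a common word form a step
function with two steps. -/
theorem Near.exists_steps {z u v : ℤ → Bool} (hu : Near z u) (hv : Near z v) (N : ℤ) :
    ∃ a b p q : ℤ, |a| ≤ 1 ∧ |b| ≤ 1 ∧ ∀ m, ∑ k ∈ Finset.Ico m N, val u k -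
      ∑ k ∈ Finset.Ico m N, val v k = (if m ≤ p then a else 0) + (if m ≤ q then b else 0) := by
  obtain ⟨a, p, ha, hp⟩ := hu.exists_val_sub
  obtain ⟨b, q, hb, hq⟩ := hv.exists_val_sub
  refine ⟨if p < N then -a else 0, if q < N then b else 0, p, q, ?_, ?_, fun m => ?_⟩
  · split_ifs <;> simp [ha]
  · split_ifs <;> simp [hb]
  · rw [← sum_ite_Ico, ← sum_ite_Ico, ← Finset.sum_add_distrib, ← Finset.sum_sub_distrib]
    refine Finset.sum_congr rfl fun k _ => ?_
    have h1 := hp k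
    have h2 := hq k
    split_ifs at h1 h2 ⊢ <;> linarith

/-- The suffix sums of the difference of two aligned words: two steps and a term of constant
sign. -/
theorem suffixDiff_formula {x y z : ℤ → Bool} {n i j : ℤ} (hij : i ≤ j) (hjn : j < n)
    (hu : Near z (del i x)) (hv : Near z (del j y)) :
    ∃ a b p q : ℤ, |a| ≤ 1 ∧ |b| ≤ 1 ∧ ∃ E : ℤ → ℤ,
      (∀ m, m ≤ n → suffixDiff x y n m =
        E m + ((if m ≤ p then a else 0) + (if m ≤ q then b else 0))) ∧
      ∀ m, -val y j ≤ E m ∧ E m ≤ 1 - val y j := by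
  obtain ⟨a, b, p, q, ha, hb, hD⟩ := hu.exists_steps hv (n - 1)
  refine ⟨a, b, if p < j then p else p + 1, if q < j then q else q + 1, ha, hb,
    fun m => if m ≤ i then val x i - val y j else if m ≤ j then val x m - val y j else 0,
    fun m hmn => ?_, fun m => ?_⟩
  · unfold suffixDiff
    rw [Finset.sum_sub_distrib]
    rcases le_or_gt m j with hmj | hmj
    · have hD' := hD m
      have e1 : (if m ≤ (if p < j then p else p + 1) then a else 0) = if m ≤ p then a else 0 := by
        split_ifs <;> first | rfl | omega
      have e2 : (if m ≤ (if q < j then q else q + 1) then b else 0) = if m ≤ q then b else 0 := by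
        split_ifs <;> first | rfl | omega
      dsimp only
      rw [e1, e2, ← hD', sum_val_of_le (x := y) hjn hmj]
      rcases le_or_gt m i with hmi | hmi
      · rw [sum_val_of_le (x := x) (by omega) hmi, if_pos hmi]
        ring
      · rw [sum_val_of_lt (x := x) hmi, if_neg (by omega), if_pos hmj,
          sum_Ico_split _ (by omega : m - 1 ≤ m) (by omega : m ≤ n - 1)]
        have h := sum_Ico_singleton (val (del i x)) (m - 1)
        rw [sub_add_cancel] at h
        have h' : val (del i x) (m - 1) = val x m := by
          simp only [val, del_of_le x (by omega : i ≤ m - 1), sub_add_cancel]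
        rw [h, h']
        ring
    · have hD' := hD (m - 1)
      have e1 : (if m ≤ (if p < j then p else p + 1) then a else 0) =
          if m - 1 ≤ p then a else 0 := by
        split_ifs <;> first | rfl | omega
      have e2 : (if m ≤ (if q < j then q else q + 1) then b else 0) =
          if m - 1 ≤ q then b else 0 := by
        split_ifs <;> first | rfl | omega
      dsimp only
      rw [e1, e2, ← hD', sum_val_of_lt (x := y) hmj, sum_val_of_lt (x := x) (by omega : i < m), if_neg (by omega),
        if_neg (by omega)]
      ring
  · have := val_nonneg x i
    have := val_le_one x i
    have := val_nonneg x m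
    have := val_le_one x m
    have := val_nonneg y j
    have := val_le_one y j
    dsimp only
    split_ifs <;> omega

theorem abs_suffixDiff_le_three {x y z : ℤ → Bool} {n i j : ℤ} (hin : i < n) (hjn : j < n)
    (hu : Near z (del i x)) (hv : Near z (del j y)) {m : ℤ} (hm : m ≤ n) :
    |suffixDiff x y n m| ≤ 3 := by
  have key : ∀ {x y : ℤ → Bool} {i j : ℤ}, i ≤ j → j < n → Near z (del i x) → Near z (del j y) →
      |suffixDiff x y n m| ≤ 3 := by
    intro x y i j hij hjn hu hv
    obtain ⟨a, b, p, q, ha, hb, E, hS, hE⟩ := suffixDiff_formula hij hjn hu hv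
    rw [hS m hm]
    have := hE m
    have := val_nonneg y j
    have := val_le_one y j
    rw [abs_le] at ha hb ⊢
    split_ifs <;> omega
  rcases le_total i j with h | h
  · exact key h hjn hu hv
  · rw [← abs_neg, ← suffixDiff_swap]
    exact key h hin hv hu

/-- The values of `S` on `[0, n]` are at most `2` in absolute value and change sign at most
twice. -/
def FewSignChanges (S : ℤ → ℤ) (n : ℤ) : Prop :=
  ∃ s c d : ℤ, (s = 1 ∨ s = -1) ∧ c ≤ d ∧ ∀ m, 0 ≤ m → m ≤ n →
    |S m| ≤ 2 ∧ (c < m → m ≤ d → s * S m ≤ 0) ∧ (m ≤ c ∨ d < m → 0 ≤ s * S m)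

theorem FewSignChanges.neg {S : ℤ → ℤ} {n : ℤ} (h : FewSignChanges S n) :
    FewSignChanges (fun m => -S m) n := by
  obtain ⟨s, c, d, hs, hcd, h⟩ := h
  refine ⟨-s, c, d, by omega, hcd, fun m h0 hn => ?_⟩
  simpa using h m h0 hn

/-- The step part equals -1 on one interval and 0 or 1 elsewhere; adding a term in [0, 1] makes `S`
nonpositive on the interval and nonnegative off it. -/
theorem fewSignChanges_of_steps {S E : ℤ → ℤ} {n a b p q : ℤ} (ha : |a| ≤ 1) (hb : |b| ≤ 1)
    (hab : -1 ≤ a + b) (hab' : a + b ≤ 0) (hE : ∀ m, 0 ≤ E m ∧ E m ≤ 1)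
    (hS : ∀ m, 0 ≤ m → m ≤ n →
      S m = E m + ((if m ≤ p then a else 0) + (if m ≤ q then b else 0))) :
    FewSignChanges S n := by
  have key : ∃ c d : ℤ, c ≤ d ∧ ∀ m, 0 ≤ m →
      (c < m → m ≤ d → (if m ≤ p then a else 0) + (if m ≤ q then b else 0) = -1) ∧
      (m ≤ c ∨ d < m → (if m ≤ p then a else 0) + (if m ≤ q then b else 0) = 0 ∨
        (if m ≤ p then a else 0) + (if m ≤ q then b else 0) = 1) := by
    rw [abs_le] at ha hb
    have h : (a = 0 ∧ b = 0) ∨ (a = 0 ∧ b = -1) ∨ (a = -1 ∧ b = 0) ∨ (a = 1 ∧ b = -1) ∨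
        (a = -1 ∧ b = 1) := by omega
    rcases h with ⟨rfl, rfl⟩ | ⟨rfl, rfl⟩ | ⟨rfl, rfl⟩ | ⟨rfl, rfl⟩ | ⟨rfl, rfl⟩
    · exact ⟨0, 0, le_rfl, fun m _ => ⟨fun _ _ => by omega, fun _ => by simp⟩⟩
    -- The left end -1 makes the interval start at 0; the maximum yields an empty interval if the
    -- step lies to the left of 0.
    · refine ⟨-1, max (-1) q, le_max_left _ _, fun m hm => ⟨fun _ _ => ?_, fun _ => ?_⟩⟩ <;>
        split_ifs <;> omega
    · refine ⟨-1, max (-1) p, le_max_left _ _, fun m hm => ⟨fun _ _ => ?_, fun _ => ?_⟩⟩ <;>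
        split_ifs <;> omega
    · refine ⟨p, max p q, le_max_left _ _, fun m hm => ⟨fun _ _ => ?_, fun _ => ?_⟩⟩ <;>
        split_ifs <;> omega
    · refine ⟨q, max q p, le_max_left _ _, fun m hm => ⟨fun _ _ => ?_, fun _ => ?_⟩⟩ <;>
        split_ifs <;> omega
  obtain ⟨c, d, hcd, h⟩ := key
  refine ⟨1, c, d, Or.inl rfl, hcd, fun m h0 hn => ?_⟩
  rw [hS m h0 hn, one_mul, abs_le]
  have := hE m
  obtain ⟨h1, h2⟩ := h m h0
  generalize (if m ≤ p then a else 0) + (if m ≤ q then b else 0) = D at *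
  omega

theorem fewSignChanges_suffixDiff {x y z : ℤ → Bool} {n i j : ℤ} (hi : 0 ≤ i) (hin : i < n)
    (hjn : j < n) (hu : Near z (del i x)) (hv : Near z (del j y))
    (h0 : suffixDiff x y n 0 = 0) : FewSignChanges (suffixDiff x y n) n := by
  have key : ∀ {x y : ℤ → Bool} {i j : ℤ}, i ≤ j → j < n → Near z (del i x) → Near z (del j y) →
      suffixDiff x y n 0 = 0 → FewSignChanges (suffixDiff x y n) n := by
    intro x y i j hij hjn hu hv h0
    obtain ⟨a, b, p, q, ha, hb, E, hS, hE⟩ := suffixDiff_formula hij hjn hu hv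
    rw [hS 0 (by omega)] at h0
    have hE0 := hE 0
    rw [abs_le] at ha hb
    -- Steps to the left of 0 are dropped, so that `h0` reads: the sum of the step heights is -`E
    -- 0`.
    have hS' : ∀ m, 0 ≤ m → m ≤ n → suffixDiff x y n m =
        E m + ((if m ≤ p then (if 0 ≤ p then a else 0) else 0) +
          (if m ≤ q then (if 0 ≤ q then b else 0) else 0)) := fun m hm hmn => by
      rw [hS m hmn]
      split_ifs <;> omega
    rcases val_eq_zero_or_one y j with hyj | hyj
    · refine fewSignChanges_of_steps (E := E) ?_ ?_ ?_ ?_ (fun m => ?_) hS'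
      · rw [abs_le]; split_ifs <;> omega
      · rw [abs_le]; split_ifs <;> omega
      · omega
      · omega
      · have := hE m; omega
    · have := fewSignChanges_of_steps (S := fun m => -suffixDiff x y n m) (E := fun m => -E m)
        (n := n) (a := -(if 0 ≤ p then a else 0)) (b := -(if 0 ≤ q then b else 0))
        (p := p) (q := q) ?_ ?_ ?_ ?_ (fun m => ?_) (fun m hm hmn => ?_)
      · simpa using this.neg
      · rw [abs_neg, abs_le]; split_ifs <;> omega
      · rw [abs_neg, abs_le]; split_ifs <;> omega
      · omega
      · omega
      · have := hE m
        omega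
      · rw [hS' m hm hmn]
        split_ifs <;> omega
  rcases le_total i j with h | h
  · exact key h hjn hu hv h0
  · have := (key h hin hv hu (by rw [suffixDiff_swap, h0, neg_zero])).neg
    rwa [show (fun m => -suffixDiff y x n m) = suffixDiff x y n from
      funext fun m => (suffixDiff_swap y x n m).symm] at this

/-- A function with at most two sign changes whose first three moments vanish is zero. -/
theorem FewSignChanges.eq_zero {S : ℤ → ℤ} {n : ℤ} (h : FewSignChanges S n) {s₀ : ℤ} {N : ℕ}
    (hs₀ : 0 ≤ s₀) (hN : s₀ + N ≤ n)
    (hmom : ∀ k < 3, ∑ r ∈ Finset.range N, ((r : ℤ) + 1) ^ k * S (s₀ + r) = 0) :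
    ∀ r < N, S (s₀ + r) = 0 := by
  obtain ⟨s, c, d, hs, hcd, h⟩ := h
  -- The roots c + 1/2 and d + 1/2 sit at the sign changes, so `w` has the sign of s·S termwise, and
  -- its odd factors never vanish at integers.
  let w : ℤ → ℤ := fun m => (2 * m - 2 * c - 1) * (2 * m - 2 * d - 1)
  have hnonneg : ∀ r ∈ Finset.range N, 0 ≤ w (s₀ + r) * (s * S (s₀ + r)) := fun r hr => by
    rw [Finset.mem_range] at hr
    obtain ⟨-, h1, h2⟩ := h (s₀ + r) (by omega) (by omega)
    by_cases hr1 : s₀ + r ≤ c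
    · exact mul_nonneg (mul_nonneg_of_nonpos_of_nonpos (by omega) (by omega)) (h2 (Or.inl hr1))
    by_cases hr2 : d < s₀ + r
    · exact mul_nonneg (mul_nonneg (by omega) (by omega)) (h2 (Or.inr hr2))
    · exact mul_nonneg_of_nonpos_of_nonpos
        (mul_nonpos_of_nonneg_of_nonpos (by omega) (by omega)) (h1 (by omega) (by omega))
  have hsum : ∑ r ∈ Finset.range N, w (s₀ + r) * (s * S (s₀ + r)) = 0 := by
    have h0 := hmom 0 (by norm_num)
    have h1 := hmom 1 (by norm_num)
    have h2 := hmom 2 (by norm_num)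
    -- In terms of r + 1 the factors of `w` are 2(r + 1) + `A` and 2(r + 1) + `B`.
    let A : ℤ := 2 * s₀ - 2 * c - 3
    let B : ℤ := 2 * s₀ - 2 * d - 3
    have e : ∑ r ∈ Finset.range N, w (s₀ + r) * (s * S (s₀ + r)) =
        s * A * B * ∑ r ∈ Finset.range N, ((r : ℤ) + 1) ^ 0 * S (s₀ + r) +
        2 * s * (A + B) * ∑ r ∈ Finset.range N, ((r : ℤ) + 1) ^ 1 * S (s₀ + r) +
        4 * s * ∑ r ∈ Finset.range N, ((r : ℤ) + 1) ^ 2 * S (s₀ + r) := by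
      rw [Finset.mul_sum, Finset.mul_sum, Finset.mul_sum, ← Finset.sum_add_distrib,
        ← Finset.sum_add_distrib]
      refine Finset.sum_congr rfl fun r _ => ?_
      simp only [w, A, B]
      ring
    rw [e, h0, h1, h2]
    ring
  intro r hr
  have := (Finset.sum_eq_zero_iff_of_nonneg hnonneg).1 hsum r (Finset.mem_range.2 hr)
  have hw : w (s₀ + r) ≠ 0 := mul_ne_zero (by omega) (by omega)
  have hs' : s ≠ 0 := by omega
  simpa [hw, hs'] using this

/-! ### Lists as two-sided infinite words -/

/-- The list `x`, padded with `false` on both sides. -/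
def ext (x : List Bool) : ℤ → Bool := fun m => if 0 ≤ m then x.getD m.toNat false else false

theorem ext_natCast (x : List Bool) (k : ℕ) : ext x k = x.getD k false := by
  simp [ext]

theorem ext_of_neg (x : List Bool) {m : ℤ} (h : m < 0) : ext x m = false := by
  simp [ext, not_le.mpr h]

theorem ext_of_length_le (x : List Bool) {m : ℤ} (h : (x.length : ℤ) ≤ m) : ext x m = false := by
  obtain ⟨k, rfl⟩ := Int.eq_ofNat_of_zero_le (show 0 ≤ m by omega)
  rw [ext_natCast]
  exact List.getD_eq_default _ _ (by exact_mod_cast h)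

theorem ext_injOn {x y : List Bool} (hlen : x.length = y.length) (h : ext x = ext y) : x = y := by
  refine List.ext_getElem hlen fun k hk hk' => ?_
  have := congrFun h k
  rw [ext_natCast, ext_natCast] at this
  rwa [List.getD_eq_getElem _ _ hk, List.getD_eq_getElem _ _ hk'] at this

theorem ext_eraseIdx (x : List Bool) (i : ℕ) : ext (x.eraseIdx i) = del i (ext x) := by
  funext m
  rcases lt_or_ge m 0 with hm | hm
  · rw [ext_of_neg _ hm, del_of_lt _ (by omega), ext_of_neg _ hm]
  obtain ⟨k, rfl⟩ := Int.eq_ofNat_of_zero_le hm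
  rw [ext_natCast]
  simp only [List.getD_eq_getElem?_getD, List.getElem?_eraseIdx]
  split_ifs with h
  · rw [del_of_lt _ (by exact_mod_cast h), ext_natCast, List.getD_eq_getElem?_getD]
  · rw [del_of_le _ (by exact_mod_cast not_lt.mp h), ← Nat.cast_succ, ext_natCast,
      List.getD_eq_getElem?_getD]

theorem exists_eq_eraseIdx_of_sublist {α : Type*} {y x : List α} (h : y.Sublist x)
    (hlen : y.length + 1 = x.length) : ∃ i < x.length, y = x.eraseIdx i := by
  induction h with
  | slnil => simp at hlen
  | @cons l₁ l₂ a h ih =>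
    have : l₁ = l₂ := h.eq_of_length (by simpa using hlen)
    exact ⟨0, by simp, by simp [this]⟩
  | @cons_cons l₁ l₂ a h ih =>
    obtain ⟨i, hi, rfl⟩ := ih (by simpa using hlen)
    exact ⟨i + 1, by simpa using hi, by simp⟩

theorem eq_of_hdist_eq_zero : ∀ {u v : List Bool}, u.length = v.length → hdist u v = 0 → u = v
  | [], [], _, _ => rfl
  | a :: u, b :: v, hlen, h => by
    simp only [hdist, List.zip_cons_cons, List.countP_cons] at h
    have hab : a = b := by
      by_contra hne
      simp [hne] at h
    have := eq_of_hdist_eq_zero (u := u) (v := v) (by simpa using hlen) (by simp only [hdist]; omega)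
    rw [hab, this]

theorem exists_of_hdist_le_one : ∀ {u v : List Bool}, u.length = v.length → hdist u v ≤ 1 →
    ∃ p : ℕ, ∀ m, m ≠ p → u.getD m false = v.getD m false
  | [], [], _, _ => ⟨0, fun _ _ => rfl⟩
  | a :: u, b :: v, hlen, h => by
    simp only [hdist, List.zip_cons_cons, List.countP_cons] at h
    have hlen' : u.length = v.length := by simpa using hlen
    by_cases hab : a = b
    · obtain ⟨p, hp⟩ := exists_of_hdist_le_one hlen' (by simp only [hdist]; omega)
      refine ⟨p + 1, fun m hm => ?_⟩
      cases m with
      | zero => simpa using hab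
      | succ m => simpa using hp m (by omega)
    · have huv := eq_of_hdist_eq_zero hlen' (by
        simp only [hdist]
        simp [hab] at h
        simpa using h)
      refine ⟨0, fun m hm => ?_⟩
      cases m with
      | zero => exact (hm rfl).elim
      | succ m => simp [huv]

theorem near_ext {u v : List Bool} (hlen : u.length = v.length) (h : hdist u v ≤ 1) :
    Near (ext v) (ext u) := by
  obtain ⟨p, hp⟩ := exists_of_hdist_le_one hlen h
  refine ⟨p, fun m hm => ?_⟩
  rcases lt_or_ge m 0 with hm0 | hm0
  · rw [ext_of_neg _ hm0, ext_of_neg _ hm0]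
  obtain ⟨k, rfl⟩ := Int.eq_ofNat_of_zero_le hm0
  rw [ext_natCast, ext_natCast]
  exact (hp k (by rintro rfl; exact hm rfl)).symm

theorem exists_near_of_mem_dsBall {x z : List Bool} (h : z ∈ dsBall x) :
    z.length + 1 = x.length ∧ ∃ i : ℤ, 0 ≤ i ∧ i < x.length ∧ Near (ext z) (del i (ext x)) := by
  obtain ⟨y, ⟨hlen, hsub⟩, hz, hd⟩ := h
  obtain ⟨i, hi, rfl⟩ := exists_eq_eraseIdx_of_sublist hsub hlen
  refine ⟨by omega, i, by omega, by exact_mod_cast hi, ?_⟩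
  rw [← ext_eraseIdx]
  exact near_ext hz.symm hd

theorem encard_dsBall_inter_le (x y : List Bool) :
    (dsBall x ∩ dsBall y).encard ≤
      (forwardSet (ext x) (ext y) ∪ forwardSet (ext y) (ext x)).encard := by
  have hinj : Set.InjOn ext (dsBall x ∩ dsBall y) := fun u hu v hv huv =>
    ext_injOn (by
      have := (exists_near_of_mem_dsBall hu.1).1
      have := (exists_near_of_mem_dsBall hv.1).1
      omega) huv
  rw [← hinj.encard_image]
  refine Set.encard_le_encard ?_
  rintro _ ⟨z, ⟨hx, hy⟩, rfl⟩
  obtain ⟨-, i, -, -, hi⟩ := exists_near_of_mem_dsBall hx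
  obtain ⟨-, j, -, -, hj⟩ := exists_near_of_mem_dsBall hy
  rcases le_total i j with h | h
  · exact Or.inl ⟨i, j, h, hi, hj⟩
  · exact Or.inr ⟨j, i, h, hj, hi⟩

/-! ### Syndromes as moments of suffix sums -/

theorem vt_zero_eq (x : List Bool) :
    vt 0 x = ∑ r ∈ Finset.range x.length, (x.getD r false).toNat := by
  rw [Finset.sum_range]
  simp [vt]

/-- Exchanging the two summations turns the syndrome into a power moment of the suffix weights. -/
theorem vt_succ_eq (k : ℕ) (x : List Bool) :
    vt (k + 1) x = ∑ r ∈ Finset.range x.length,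
      (r + 1) ^ k * ∑ c ∈ Finset.Ico r x.length, (x.getD c false).toNat := by
  have h1 : vt (k + 1) x = ∑ i ∈ Finset.range x.length,
      ∑ j ∈ Finset.range (i + 1), (j + 1) ^ k * (x.getD i false).toNat := by
    rw [Finset.sum_range]
    simp only [vt]
    refine Finset.sum_congr rfl fun i _ => ?_
    rw [Finset.range_eq_Ico, Finset.sum_Ico_add' (fun j => j ^ k * (x.getD i false).toNat)]
    refine Finset.sum_congr ?_ fun j _ => ?_
    · ext; simp
    · simp
  rw [h1]
  simp only [Finset.mul_sum]
  refine Finset.sum_comm' fun a b => ?_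
  simp
  omega

theorem sum_Ico_natCast (g : ℤ → ℤ) (a b : ℕ) :
    ∑ c ∈ Finset.Ico a b, g (c : ℤ) = ∑ m ∈ Finset.Ico (a : ℤ) b, g m := by
  refine Finset.sum_bij' (fun c _ => (c : ℤ)) (fun m _ => m.toNat) ?_ ?_ ?_ ?_ ?_ <;>
    simp only [Finset.mem_Ico] <;> intros <;> first | rfl | omega | simp

theorem val_ext_natCast (x : List Bool) (k : ℕ) :
    val (ext x) k = ((x.getD k false).toNat : ℤ) := by
  rw [val, ext_natCast]

theorem vt_zero_sub {x y : List Bool} {n : ℕ} (hx : x.length = n) (hy : y.length = n) :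
    (vt 0 x : ℤ) - vt 0 y = suffixDiff (ext x) (ext y) n 0 := by
  rw [vt_zero_eq, vt_zero_eq, hx, hy, suffixDiff, ← Nat.cast_zero (R := ℤ),
    ← sum_Ico_natCast (fun k => val (ext x) k - val (ext y) k), ← Finset.range_eq_Ico]
  push_cast
  rw [← Finset.sum_sub_distrib]
  simp only [val_ext_natCast]

/-- The syndromes of a window that contains all differences. -/
theorem vt_window_sub {x y : List Bool} {n s N : ℕ} (hx : x.length = n) (hy : y.length = n)
    (h : ∀ m : ℤ, (s + N : ℕ) ≤ m → ext x m = ext y m) (hN : s + N ≤ n) (k : ℕ) {M : ℕ}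
    (hM : min M (n - s) = N) :
    (vt (k + 1) ((x.drop s).take M) : ℤ) - vt (k + 1) ((y.drop s).take M) =
      ∑ r ∈ Finset.range N, ((r : ℤ) + 1) ^ k * suffixDiff (ext x) (ext y) n (s + r) := by
  have hlx : ((x.drop s).take M).length = N := by simp [hx, hM]
  have hly : ((y.drop s).take M).length = N := by simp [hy, hM]
  have hget : ∀ (w : List Bool) (c : ℕ), c < N → ((w.drop s).take M).getD c false =
      w.getD (s + c) false := fun w c hc => by
    simp only [List.getD_eq_getElem?_getD]
    rw [List.getElem?_take_of_lt (by omega), List.getElem?_drop]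
  rw [vt_succ_eq, vt_succ_eq, hlx, hly]
  push_cast
  rw [← Finset.sum_sub_distrib]
  refine Finset.sum_congr rfl fun r hr => ?_
  rw [Finset.mem_range] at hr
  rw [← mul_sub, ← Finset.sum_sub_distrib]
  congr 1
  have hstart : suffixDiff (ext x) (ext y) n (s + r) =
      ∑ m ∈ Finset.Ico ((r : ℤ) + s) (N + s), (val (ext x) m - val (ext y) m) := by
    rw [suffixDiff, add_comm (s : ℤ), sum_Ico_split _ (by omega : (r : ℤ) + s ≤ N + s)
      (by omega : (N : ℤ) + s ≤ n), add_eq_left]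
    refine Finset.sum_eq_zero fun m hm => ?_
    rw [Finset.mem_Ico] at hm
    rw [val_congr (h m (by push_cast; omega)), sub_self]
  rw [hstart, ← Finset.sum_Ico_add' (fun m => val (ext x) m - val (ext y) m),
    ← sum_Ico_natCast (fun m => val (ext x) (m + s) - val (ext y) (m + s))]
  refine Finset.sum_congr rfl fun c hc => ?_
  rw [Finset.mem_Ico] at hc
  rw [hget x c hc.2, hget y c hc.2, ← Nat.cast_add, val_ext_natCast, val_ext_natCast, add_comm c s]

theorem abs_moment_le {S : ℤ → ℤ} {n : ℤ} (h : FewSignChanges S n) {s N : ℕ} (hN : s + N ≤ n)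
    (k : ℕ) : |∑ r ∈ Finset.range N, ((r : ℤ) + 1) ^ k * S (s + r)| ≤ 2 * (N : ℤ) ^ (k + 1) := by
  obtain ⟨_, _, _, _, _, h⟩ := h
  calc |∑ r ∈ Finset.range N, ((r : ℤ) + 1) ^ k * S (s + r)|
      ≤ ∑ r ∈ Finset.range N, |((r : ℤ) + 1) ^ k * S (s + r)| := Finset.abs_sum_le_sum_abs _ _
    _ ≤ ∑ r ∈ Finset.range N, (N : ℤ) ^ k * 2 := by
        refine Finset.sum_le_sum fun r hr => ?_
        rw [Finset.mem_range] at hr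
        rw [abs_mul, abs_of_nonneg (by positivity : (0 : ℤ) ≤ ((r : ℤ) + 1) ^ k)]
        have hle : (r : ℤ) + 1 ≤ N := by omega
        gcongr
        exact (h (s + r) (by omega) (by omega)).1
    _ = 2 * (N : ℤ) ^ (k + 1) := by
        rw [Finset.sum_const, Finset.card_range, nsmul_eq_mul]
        ring

/-! ### The reconstruction property -/

theorem aperiodic_ext {n t : ℕ} {x : List Bool} (hx : x ∈ periodBounded n 2 t) {f l : ℤ}
    (hf : 0 ≤ f) (hl : l < n) : Aperiodic t (ext x) f l := by
  obtain ⟨hlen, hper⟩ := hx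
  have hlen : x.length = n := hlen
  intro a hfa hal
  by_contra! hcon
  lift a to ℕ using by omega
  let w := (x.drop a).take (t + 1)
  have hwlen : w.length = t + 1 := by
    simp only [w, List.length_take, List.length_drop]
    omega
  have hw : w <:+: x := (List.take_prefix _ _).isInfix.trans (List.drop_suffix _ _).isInfix
  have hget : ∀ k, k < t + 1 → w[k]? = some (ext x ((a + k : ℕ) : ℤ)) := fun k hk => by
    rw [ext_natCast, List.getD_eq_getElem _ _ (by omega)]
    simp only [w]
    rw [List.getElem?_take_of_lt hk, List.getElem?_drop, List.getElem?_eq_getElem (by omega)]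
  have hshift : ShiftInvariant 2 w := fun k hk => by
    rw [hget k (by omega), hget (k + 2) (by omega)]
    have := hcon ((a + k : ℕ) : ℤ) (by omega) (by omega)
    rw [this]
    congr 2
  have hmem : 2 ∈ {q | 0 < q ∧ ShiftInvariant q w} := ⟨by norm_num, hshift⟩
  have hle := hper w hw ⟨sInf {q | 0 < q ∧ ShiftInvariant q w}, Nat.sInf_le hmem,
    Nat.sInf_mem ⟨2, hmem⟩, fun q hq => Nat.sInf_le hq⟩
  omega

/-- The differences are signs ±1. Order 0 excludes one or three of them, and order 1 excludes two
opposite signs at distinct positions, so at least four exist. -/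
theorem exists_config {x y : ℤ → Bool} {n : ℤ} (hne : x ≠ y)
    (hout : ∀ m, m < 0 ∨ n ≤ m → x m = y m)
    (h0 : ∑ m ∈ Finset.Ico 0 n, (val x m - val y m) = 0)
    (h1 : ∑ m ∈ Finset.Ico 0 n, m * (val x m - val y m) = 0) :
    ∃ f f₂ l₂ l, Config x y f f₂ l₂ l ∧ 0 ≤ f ∧ l < n := by
  classical
  let Δ : Finset ℤ := (Finset.Ico 0 n).filter fun m => x m ≠ y m
  have hΔ : ∀ m, m ∈ Δ ↔ x m ≠ y m := fun m => by
    simp only [Δ, Finset.mem_filter, Finset.mem_Ico, and_iff_right_iff_imp]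
    intro h
    by_contra hm
    exact h (hout m (by omega))
  have hval : ∀ m, m ∉ Δ → val x m - val y m = 0 := fun m hm => by
    rw [val_congr (not_not.1 (mt (hΔ m).2 hm)), sub_self]
  have hsum : ∀ (s : Finset ℤ) (w : ℤ → ℤ), Δ ⊆ s →
      ∑ m ∈ s, w m * (val x m - val y m) = ∑ m ∈ Δ, w m * (val x m - val y m) := fun s w hs =>
    (Finset.sum_subset hs fun m _ hm => by rw [hval m hm, mul_zero]).symm
  have hsub : Δ ⊆ Finset.Ico 0 n := Finset.filter_subset _ _
  have hne' : Δ.Nonempty := by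
    obtain ⟨m, hm⟩ := Function.ne_iff.1 hne
    exact ⟨m, (hΔ m).2 hm⟩
  let f := Δ.min' hne'
  let l := Δ.max' hne'
  have hfΔ : f ∈ Δ := Δ.min'_mem hne'
  have hlΔ : l ∈ Δ := Δ.max'_mem hne'
  have hfmin : ∀ m ∈ Δ, f ≤ m := fun m hm => Δ.min'_le m hm
  have hlmax : ∀ m ∈ Δ, m ≤ l := fun m hm => Δ.le_max' m hm
  have hsubIcc : Δ ⊆ Finset.Icc f l := fun m hm => Finset.mem_Icc.2 ⟨hfmin m hm, hlmax m hm⟩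
  have hd0 : ∑ m ∈ Δ, 1 * (val x m - val y m) = 0 := by
    rw [← hsum _ (fun _ => 1) hsub]
    simpa using h0
  have hd1 : ∑ m ∈ Δ, m * (val x m - val y m) = 0 := by
    rw [← hsum _ (fun m => m) hsub]
    exact h1
  have hδf := val_sub_of_ne ((hΔ f).1 hfΔ)
  have hδl := val_sub_of_ne ((hΔ l).1 hlΔ)
  have hfl : f ≠ l := by
    intro h
    have : Δ = {f} := Finset.eq_singleton_iff_unique_mem.2
      ⟨hfΔ, fun m hm => le_antisymm (h ▸ hlmax m hm) (hfmin m hm)⟩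
    rw [this, Finset.sum_singleton] at hd0
    omega
  have hlΔ' : l ∈ Δ.erase f := Finset.mem_erase.2 ⟨hfl.symm, hlΔ⟩
  rw [← Finset.add_sum_erase _ _ hfΔ, ← Finset.add_sum_erase _ _ hlΔ'] at hd0 hd1
  have hne2 : ((Δ.erase f).erase l).Nonempty := by
    rw [Finset.nonempty_iff_ne_empty]
    intro h
    rw [h, Finset.sum_empty] at hd0 hd1
    rcases hδf with h | h <;> rcases hδl with h' | h' <;> rw [h, h'] at hd0 hd1 <;> omega
  let f₂ := ((Δ.erase f).erase l).min' hne2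
  let l₂ := ((Δ.erase f).erase l).max' hne2
  have hf₂ : f₂ ∈ (Δ.erase f).erase l := Finset.min'_mem _ hne2
  have hl₂ : l₂ ∈ (Δ.erase f).erase l := Finset.max'_mem _ hne2
  have hf₂min : ∀ m ∈ (Δ.erase f).erase l, f₂ ≤ m := fun m hm => Finset.min'_le _ m hm
  have hl₂max : ∀ m ∈ (Δ.erase f).erase l, m ≤ l₂ := fun m hm => Finset.le_max' _ m hm
  have hδf₂ := hf₂
  have hδl₂ := hl₂
  simp only [Finset.mem_erase] at hδf₂ hδl₂
  have hlt : f₂ ≠ l₂ := by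
    intro h
    have he : (Δ.erase f).erase l = {f₂} := Finset.eq_singleton_iff_unique_mem.2
      ⟨hf₂, fun m hm => le_antisymm (h ▸ hl₂max m hm) (hf₂min m hm)⟩
    rw [he, Finset.sum_singleton] at hd0
    have := val_sub_of_ne ((hΔ f₂).1 hδf₂.2.2)
    omega
  have hgap : ∀ m, m ∉ (Δ.erase f).erase l → m ≠ f → m ≠ l → x m = y m := fun m hm hmf hml => by
    by_contra h
    exact hm (by simp [hmf, hml, hΔ, h])
  have hf0 := Finset.mem_Ico.1 (hsub hfΔ)
  have hl0 := Finset.mem_Ico.1 (hsub hlΔ)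
  have hle1 := hfmin f₂ hδf₂.2.2
  have hle2 := hf₂min l₂ hl₂
  have hle3 := hlmax l₂ hδl₂.2.2
  refine ⟨f, f₂, l₂, l, ?_, hf0.1, hl0.2⟩
  exact {
    lt_first := by omega
    lt_mid := by omega
    lt_last := by omega
    ne_f := (hΔ f).1 hfΔ
    ne_f₂ := (hΔ f₂).1 hδf₂.2.2
    ne_l₂ := (hΔ l₂).1 hδl₂.2.2
    ne_l := (hΔ l).1 hlΔ
    before := fun m hm => by
      by_contra h
      have := hfmin m ((hΔ m).2 h)
      omega
    gap_first := fun m hm hm' => hgap m (fun h => by have := hf₂min m h; omega) (by omega)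
      (by omega)
    gap_last := fun m hm hm' => hgap m (fun h => by have := hl₂max m h; omega) (by omega)
      (by omega)
    after := fun m hm => by
      by_contra h
      have := hlmax m ((hΔ m).2 h)
      omega
    sum_zero := by
      have := hsum _ (fun _ => 1) hsubIcc
      rw [← hsum _ (fun _ => 1) hsub] at this
      simpa [h0] using this
    sum_one := by
      have := hsum _ (fun m => m) hsubIcc
      rw [← hsum _ (fun m => m) hsub, h1] at this
      rw [← this]
      exact Finset.sum_congr rfl fun m _ => by ring }

theorem block_append_block (P : ℕ) (x : List Bool) {i : ℕ} (hi : 1 ≤ i) :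
    block P x i ++ block P x (i + 1) = (x.drop ((i - 1) * P)).take (2 * P) := by
  obtain ⟨j, rfl⟩ : ∃ j, i = j + 1 := ⟨i - 1, by omega⟩
  simp only [block, Nat.add_sub_cancel]
  rw [two_mul, List.take_add, List.drop_drop, add_mul, one_mul]

theorem window_eq {x y : List Bool} {s M : ℕ} (hlen : x.length = y.length)
    (h : ∀ k, s ≤ k → k < s + M → ext x k = ext y k) :
    (x.drop s).take M = (y.drop s).take M := by
  refine List.ext_getElem (by simp [hlen]) fun k hk hk' => ?_
  have hk1 := hk
  have hk2 := hk'
  rw [List.length_take, List.length_drop] at hk1 hk2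
  have := h (s + k) (by omega) (by omega)
  rw [ext_natCast, ext_natCast, List.getD_eq_getElem _ _ (by omega),
    List.getD_eq_getElem _ _ (by omega)] at this
  simpa using this

theorem modEq_of_sum_modEq {s : Finset ℕ} {F G : ℕ → ℕ} {M i₀ : ℕ} (hi₀ : i₀ ∈ s)
    (heq : ∀ i ∈ s, i ≠ i₀ → F i = G i) (h : ∑ i ∈ s, F i ≡ ∑ i ∈ s, G i [MOD M]) :
    F i₀ ≡ G i₀ [MOD M] := by
  rw [← Finset.add_sum_erase _ _ hi₀, ← Finset.add_sum_erase _ _ hi₀,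
    Finset.sum_congr rfl fun i hi => heq i (Finset.mem_of_mem_erase hi)
      (Finset.ne_of_mem_erase hi)] at h
  exact Nat.ModEq.add_right_cancel' _ h

theorem eq_of_modEq_of_abs_lt {a b M : ℕ} {D : ℤ} (h : a ≡ b [MOD M]) (hD : (a : ℤ) - b = D)
    (hlt : |D| < M) : D = 0 := by
  have hdvd : (M : ℤ) ∣ D := hD ▸ h.symm.dvd
  exact Int.eq_zero_of_abs_lt_dvd hdvd hlt

/-- Equal syndromes in a window that contains all differences are impossible. -/
theorem Config.not_modEq_window {x y : List Bool} {n P s : ℕ} {f f₂ l₂ l : ℤ} (hP : 1 ≤ P)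
    (hx : x.length = n) (hy : y.length = n) (C : Config (ext x) (ext y) f f₂ l₂ l)
    (hln : l < n) (hS : FewSignChanges (suffixDiff (ext x) (ext y) n) n)
    (hsf : s ≤ f) (hls : l < s + 2 * P)
    (hmod : ∀ k < 3, vt (k + 1) ((x.drop s).take (2 * P)) ≡ vt (k + 1) ((y.drop s).take (2 * P))
      [MOD 3 * (2 * P) ^ (k + 1)]) : False := by
  have h1 := C.lt_first
  have h2 := C.lt_mid
  have h3 := C.lt_last
  obtain ⟨N, hN⟩ : ∃ N, min (2 * P) (n - s) = N := ⟨_, rfl⟩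
  have hsN : s + N ≤ n := by omega
  have hout : ∀ m : ℤ, (s + N : ℕ) ≤ m → ext x m = ext y m := fun m hm => by
    push_cast at hm
    rcases le_total (2 * P) (n - s) with h | h
    · rw [min_eq_left h] at hN
      exact C.after m (by omega)
    · rw [min_eq_right h] at hN
      rw [ext_of_length_le x (by omega), ext_of_length_le y (by omega)]
  have hzero := hS.eq_zero (s₀ := s) (N := N) (by omega) (by exact_mod_cast hsN) fun k hk => by
    have hsub := vt_window_sub hx hy hout hsN k hN
    refine eq_of_modEq_of_abs_lt (hmod k hk) hsub
      ((abs_moment_le hS (by exact_mod_cast hsN) k).trans_lt ?_)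
    have hle : (N : ℤ) ^ (k + 1) ≤ (2 * P : ℤ) ^ (k + 1) := by
      gcongr
      omega
    have hpos : (0 : ℤ) < (2 * P : ℤ) ^ (k + 1) := by positivity
    push_cast
    linarith
  obtain ⟨r, hr⟩ := Int.eq_ofNat_of_zero_le (show 0 ≤ f - s by omega)
  have e1 := hzero r (by omega)
  have e2 := hzero (r + 1) (by omega)
  rw [show (s : ℤ) + r = f by omega] at e1
  rw [show (s : ℤ) + (r + 1 : ℕ) = f + 1 by push_cast; omega] at e2
  rw [suffixDiff_eq_add _ _ (by omega), e2, add_zero] at e1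
  have := val_sub_of_ne C.ne_f
  omega

/-- With B = f / P, all differences lie in blocks B + 1 and B + 2. The parity of B decides which
pairing contains this pair; every other pair in that pairing is the same in both words and cancels.
-/
theorem Config.not_codeBlocks {x y : List Bool} {n P : ℕ} {g g' : Fin 3 → ℕ} {f f₂ l₂ l : ℤ}
    (hP : 1 ≤ P) (C : Config (ext x) (ext y) f f₂ l₂ l) (hf : 0 ≤ f) (hln : l < n)
    (hS : FewSignChanges (suffixDiff (ext x) (ext y) n) n) (hlf : l - f ≤ P)
    (hx : x ∈ codeBlocks n P g g') (hy : y ∈ codeBlocks n P g g') : False := by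
  obtain ⟨hxl, hx⟩ := hx
  obtain ⟨hyl, hy⟩ := hy
  have hxl : x.length = n := hxl
  have hyl : y.length = n := hyl
  have h1 := C.lt_first
  have h2 := C.lt_mid
  have h3 := C.lt_last
  lift f to ℕ using hf
  lift l to ℕ using by omega
  have hB := Nat.div_add_mod f P
  have hBlt := Nat.mod_lt f (show 0 < P by omega)
  set B := f / P with hBdef
  have hBn : B ≤ n / P := Nat.div_le_div_right (by omega)
  have hwin : ∀ s : ℕ, (s + 2 * P ≤ B * P ∨ (B + 2) * P ≤ s) →
      (x.drop s).take (2 * P) = (y.drop s).take (2 * P) := fun s hs =>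
    window_eq (hxl.trans hyl.symm) fun k hk hk' => by
      rcases hs with hs | hs
      · exact C.before k (by have := mul_comm P B; omega)
      · refine C.after k ?_
        have : (B + 2) * P = P * B + 2 * P := by ring
        omega
  refine C.not_modEq_window (s := B * P) hP hxl hyl hln hS ?_ ?_ fun k hk => ?_
  · have := mul_comm P B
    push_cast [← this]
    exact_mod_cast (by omega : P * B ≤ f)
  · have := mul_comm P B
    have h : l < B * P + 2 * P := by omega
    exact_mod_cast h
  obtain ⟨hx1, hx2⟩ := hx ⟨k, hk⟩
  obtain ⟨hy1, hy2⟩ := hy ⟨k, hk⟩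
  rcases Nat.even_or_odd' B with ⟨c, hc | hc⟩
  · have h := hx1.trans hy1.symm
    simp only [oddBlockSum, hxl, hyl] at h
    have hw : ∀ (w : List Bool), ∀ i ∈ Finset.Icc 1 (n / P + 1),
        block P w (2 * i - 1) ++ block P w (2 * i) =
          (w.drop ((2 * i - 2) * P)).take (2 * P) := fun w i hi => by
      rw [Finset.mem_Icc] at hi
      have := block_append_block P w (i := 2 * i - 1) (by omega)
      rwa [show 2 * i - 1 + 1 = 2 * i by omega, show 2 * i - 1 - 1 = 2 * i - 2 by omega] at this
    have hmem : c + 1 ∈ Finset.Icc 1 (n / P + 1) := by rw [Finset.mem_Icc]; omega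
    have := modEq_of_sum_modEq hmem (fun i hi hne => ?_) h
    · rwa [hw x _ hmem, hw y _ hmem, show 2 * (c + 1) - 2 = B by omega] at this
    · rw [hw x i hi, hw y i hi, hwin]
      rw [Finset.mem_Icc] at hi
      rcases lt_or_gt_of_ne hne with hlt | hgt
      · left
        rw [← add_mul]
        exact Nat.mul_le_mul_right _ (by omega)
      · right
        exact Nat.mul_le_mul_right _ (by omega)
  · have h := hx2.trans hy2.symm
    simp only [evenBlockSum, hxl, hyl] at h
    have hw : ∀ (w : List Bool), ∀ i ∈ Finset.Icc 1 (n / P + 1),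
        block P w (2 * i) ++ block P w (2 * i + 1) =
          (w.drop ((2 * i - 1) * P)).take (2 * P) := fun w i hi => by
      rw [Finset.mem_Icc] at hi
      exact block_append_block P w (i := 2 * i) (by omega)
    have hmem : c + 1 ∈ Finset.Icc 1 (n / P + 1) := by rw [Finset.mem_Icc]; omega
    have := modEq_of_sum_modEq hmem (fun i hi hne => ?_) h
    · rwa [hw x _ hmem, hw y _ hmem, show 2 * (c + 1) - 1 = B by omega] at this
    · rw [hw x i hi, hw y i hi, hwin]
      rw [Finset.mem_Icc] at hi
      rcases lt_or_gt_of_ne hne with hlt | hgt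
      · left
        rw [← add_mul]
        exact Nat.mul_le_mul_right _ (by omega)
      · right
        exact Nat.mul_le_mul_right _ (by omega)

theorem sum_range_suffixDiff (x y : ℤ → Bool) (n : ℕ) :
    ∑ r ∈ Finset.range n, suffixDiff x y n r =
      ∑ m ∈ Finset.Ico (0 : ℤ) n, (m + 1) * (val x m - val y m) := by
  rw [← Nat.cast_zero (R := ℤ), ← sum_Ico_natCast (fun m => (m + 1) * (val x m - val y m)),
    ← Finset.range_eq_Ico]
  have : ∀ r : ℕ, suffixDiff x y n r = ∑ c ∈ Finset.Ico r n, (val x c - val y c) := fun r => by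
    rw [suffixDiff, sum_Ico_natCast (fun m => val x m - val y m)]
  simp only [this]
  have h : ∑ r ∈ Finset.range n, ∑ c ∈ Finset.Ico r n, (val x c - val y c) =
      ∑ c ∈ Finset.range n, ∑ _r ∈ Finset.range (c + 1), (val x c - val y c) :=
    Finset.sum_comm' fun a b => by simp; omega
  rw [h]
  refine Finset.sum_congr rfl fun c _ => ?_
  rw [Finset.sum_const, Finset.card_range, nsmul_eq_mul]
  push_cast
  ring

theorem isReconstructionCode_code11 (n s₀ s₁ : ℕ) (hn : 1 ≤ n) (g g' : Fin 3 → ℕ) :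
    IsReconstructionCode n 11 (code11 n s₀ s₁ g g') := by
  refine ⟨fun x hx => hx.1.1.1, fun x hx y hy hne => ?_⟩
  obtain ⟨⟨hxR, hxl, hx0, hx1⟩, hxB⟩ := hx
  obtain ⟨⟨hyR, hyl, hy0, hy1⟩, hyB⟩ := hy
  have hxl : x.length = n := hxl
  have hyl : y.length = n := hyl
  rcases (dsBall x ∩ dsBall y).eq_empty_or_nonempty with he | ⟨z, hzx, hzy⟩
  · rw [he, Set.encard_empty]
    norm_num
  obtain ⟨-, i, hi0, hin, hi⟩ := exists_near_of_mem_dsBall hzx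
  obtain ⟨-, j, -, hjn, hj⟩ := exists_near_of_mem_dsBall hzy
  rw [hxl] at hin
  rw [hyl] at hjn
  have hS0 : suffixDiff (ext x) (ext y) n 0 = 0 :=
    eq_of_modEq_of_abs_lt (hx0.trans hy0.symm) (vt_zero_sub hxl hyl)
      ((abs_suffixDiff_le_three hin hjn hi hj (by omega)).trans_lt (by norm_num))
  have hS := fewSignChanges_suffixDiff hi0 hin hjn hi hj hS0
  have hS1 : ∑ r ∈ Finset.range n, suffixDiff (ext x) (ext y) n r = 0 := by
    have hsub := vt_window_sub (s := 0) (N := n) (M := n) hxl hyl (fun m hm => by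
      rw [ext_of_length_le x (by push_cast at hm; omega),
        ext_of_length_le y (by push_cast at hm; omega)]) (by omega) 0 (by omega)
    have ex : (x.drop 0).take n = x := by simp [← hxl]
    have ey : (y.drop 0).take n = y := by simp [← hyl]
    rw [ex, ey] at hsub
    simp only [pow_zero, one_mul, Nat.cast_zero, zero_add] at hsub
    refine eq_of_modEq_of_abs_lt (hx1.trans hy1.symm) hsub ?_
    obtain ⟨k, rfl⟩ : ∃ k, n = k + 1 := ⟨n - 1, by omega⟩
    -- Dropping the zero term S(0) leaves n - 1 terms of size at most 2, so the sum stays strictly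
    -- below 2n.
    rw [Finset.sum_range_succ', Nat.cast_zero, hS0, add_zero]
    have := abs_moment_le hS (s := 1) (N := k) (by push_cast; omega) 0
    simp only [pow_zero, one_mul, zero_add, pow_one, Nat.cast_one] at this
    have e : ∀ r : ℕ, ((r + 1 : ℕ) : ℤ) = 1 + r := fun r => by push_cast; ring
    simp only [e] at this ⊢
    push_cast
    linarith
  rw [sum_range_suffixDiff] at hS1
  have h0 : ∑ m ∈ Finset.Ico (0 : ℤ) n, (val (ext x) m - val (ext y) m) = 0 := hS0
  obtain ⟨f, f₂, l₂, l, C, hf, hl⟩ := exists_config (x := ext x) (y := ext y) (n := n)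
    (fun h => hne (ext_injOn (hxl.trans hyl.symm) h))
    (fun m hm => by
      rcases hm with hm | hm
      · rw [ext_of_neg _ hm, ext_of_neg _ hm]
      · rw [ext_of_length_le x (by omega), ext_of_length_le y (by omega)])
    h0 (by
      simp only [add_mul, one_mul, Finset.sum_add_distrib, h0, add_zero] at hS1
      exact hS1)
  have ht : 0 < tParam n := by unfold tParam; omega
  rcases lt_or_ge (6 * (tParam n : ℤ)) (l - f) with hlong | hshort
  · refine (encard_dsBall_inter_le x y).trans_lt ((C.encard_union_le_of_long (t := tParam n)
      (by exact_mod_cast ht) (aperiodic_ext hxR hf hl) (aperiodic_ext hyR hf hl)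
      hlong).trans_lt (by norm_num))
  · refine (C.not_codeBlocks (P := pParam n) (by unfold pParam; omega) hf hl hS ?_ hxB hyB).elim
    unfold pParam
    push_cast
    omega

/-! ### The redundancy -/

theorem finite_words (n : ℕ) : (Words n).Finite := List.finite_length_eq Bool n

theorem ncard_words (n : ℕ) : (Words n).ncard = 2 ^ n := by
  rw [← Nat.card_coe_set_eq]
  have : Nat.card (List.Vector Bool n) = 2 ^ n := by
    rw [Nat.card_eq_fintype_card, card_vector, Fintype.card_bool]
  exact this

/-- The words of length `n` for which the window of length `t + 1` at `a` has period `2`. -/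
def periodicAt (n t a : ℕ) : Set (List Bool) :=
  {x | x ∈ Words n ∧ ∀ k, a ≤ k → k + 2 ≤ a + t → x.getD k false = x.getD (k + 2) false}

theorem ncard_periodicAt_le {n t a : ℕ} (ht : 1 ≤ t) (h : a + t < n) :
    (periodicAt n t a).ncard ≤ 2 ^ (n + 1 - t) := by
  rw [← ncard_words]
  -- The first two letters of the window determine the other t - 1, which may be cut out.
  refine Set.ncard_le_ncard_of_injOn (fun x => x.take (a + 2) ++ x.drop (a + t + 1)) ?_ ?_
    (finite_words _)
  · rintro x ⟨hx, -⟩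
    have hx : x.length = n := hx
    simp only [Words, Set.mem_ofPred_eq, List.length_append, List.length_take, List.length_drop]
    omega
  · rintro x ⟨hx, hxp⟩ y ⟨hy, hyp⟩ hxy
    have hx : x.length = n := hx
    have hy : y.length = n := hy
    obtain ⟨h1, h2⟩ := List.append_inj hxy (by simp [hx, hy])
    have key : ∀ k, k < n → x.getD k false = y.getD k false := by
      intro k
      induction k using Nat.strong_induction_on with
      | _ k ih =>
        intro hk
        rcases lt_or_ge k (a + 2) with hk1 | hk1
        · have := congrArg (fun w : List Bool => w[k]?) h1
          simp only [List.getElem?_take_of_lt hk1] at this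
          simp only [List.getD_eq_getElem?_getD, this]
        rcases le_or_gt k (a + t) with hk2 | hk2
        · have e1 := hxp (k - 2) (by omega) (by omega)
          have e2 := hyp (k - 2) (by omega) (by omega)
          rw [show k - 2 + 2 = k by omega] at e1 e2
          rw [← e1, ← e2, ih (k - 2) (by omega) (by omega)]
        · have := congrArg (fun w : List Bool => w[k - (a + t + 1)]?) h2
          simp only [List.getElem?_drop] at this
          rw [show a + t + 1 + (k - (a + t + 1)) = k by omega] at this
          simp only [List.getD_eq_getElem?_getD, this]
    refine List.ext_getElem (hx.trans hy.symm) fun k hk hk' => ?_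
    have := key k (by omega)
    rwa [List.getD_eq_getElem _ _ hk, List.getD_eq_getElem _ _ hk'] at this

theorem words_subset_periodBounded_union (n t : ℕ) :
    Words n ⊆ periodBounded n 2 t ∪ ⋃ a ∈ Finset.range (n - t), periodicAt n t a := by
  intro x hx
  by_cases h : x ∈ periodBounded n 2 t
  · exact Or.inl h
  right
  have hlen : x.length = n := hx
  have h' : ¬ ∀ w : List Bool, w <:+: x → (∃ p ≤ 2, HasPeriod p w) → w.length ≤ t :=
    fun h' => h ⟨hx, h'⟩
  push Not at h'
  obtain ⟨w, ⟨u, v, rfl⟩, ⟨p, hp2, ⟨hp0, hp⟩, -⟩, hlt⟩ := h'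
  rw [List.length_append, List.length_append] at hlen
  simp only [Set.mem_iUnion, Finset.mem_range]
  refine ⟨u.length, by omega, hx, fun k hk hk' => ?_⟩
  have hget : ∀ m, u.length ≤ m → m < u.length + w.length →
      (u ++ w ++ v).getD m false = w[m - u.length]?.getD false := fun m hm hm' => by
    rw [List.getD_eq_getElem?_getD, List.append_assoc, List.getElem?_append_right hm,
      List.getElem?_append_left (by omega)]
  rw [hget k hk (by omega), hget (k + 2) (by omega) (by omega)]
  congr 1
  have : p = 1 ∨ p = 2 := by omega
  rcases this with rfl | rfl
  · rw [hp (k - u.length) (by omega), hp (k - u.length + 1) (by omega)]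
    congr 1
    omega
  · rw [hp (k - u.length) (by omega)]
    congr 1
    omega

theorem le_two_pow_tParam {n : ℕ} (hn : 1 ≤ n) : n * 8 ≤ 2 ^ tParam n := by
  unfold tParam
  rw [pow_add]
  have h : n ≤ 2 ^ ⌈Real.logb 2 (n : ℝ)⌉₊ := by
    have h1 : (n : ℝ) ≤ 2 ^ (⌈Real.logb 2 (n : ℝ)⌉₊ : ℝ) := by
      rw [← Real.logb_le_iff_le_rpow (by norm_num) (by exact_mod_cast hn)]
      exact Nat.le_ceil _
    rw [Real.rpow_natCast] at h1
    exact_mod_cast h1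
  omega

/-- Union bound over fewer than n windows; the summand 3 in `tParam` gives 8n ≤ 2^t, more than
enough to keep the bad words below one half. -/
theorem two_pow_le_periodBounded {n : ℕ} (hn : 1 ≤ n) :
    2 ^ n ≤ 2 * (periodBounded n 2 (tParam n)).ncard := by
  have hfin : ∀ a, (periodicAt n (tParam n) a).Finite := fun a =>
    (finite_words n).subset fun x hx => hx.1
  have hRfin : (periodBounded n 2 (tParam n)).Finite :=
    (finite_words n).subset fun x hx => hx.1
  have hUfin : (⋃ a ∈ Finset.range (n - tParam n), periodicAt n (tParam n) a).Finite :=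
    (Finset.range (n - tParam n)).finite_toSet.biUnion fun a _ => hfin a
  have h1 : 2 ^ n ≤ (periodBounded n 2 (tParam n)).ncard +
      (⋃ a ∈ Finset.range (n - tParam n), periodicAt n (tParam n) a).ncard := by
    rw [← ncard_words]
    exact (Set.ncard_le_ncard (words_subset_periodBounded_union n (tParam n))
      (hRfin.union hUfin)).trans (Set.ncard_union_le _ _)
  have h2 : (⋃ a ∈ Finset.range (n - tParam n), periodicAt n (tParam n) a).ncard ≤
      (n - tParam n) * 2 ^ (n + 1 - tParam n) := by
    refine (Finset.set_ncard_biUnion_le _ _).trans ?_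
    refine (Finset.sum_le_card_nsmul _ _ (2 ^ (n + 1 - tParam n)) fun a ha => ?_).trans ?_
    · rw [Finset.mem_range] at ha
      exact ncard_periodicAt_le (by unfold tParam; omega) (by omega)
    · simp
  have h3 : (n - tParam n) * 2 ^ (n + 1 - tParam n) * 2 ≤ 2 ^ n := by
    rcases le_or_gt n (tParam n) with h | h
    · rw [Nat.sub_eq_zero_of_le h]
      simp
    · have h4 := le_two_pow_tParam hn
      have h5 : 2 ^ (n + 1 - tParam n) * 2 ^ tParam n = 2 * 2 ^ n := by
        rw [← pow_add, ← pow_succ']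
        congr 1
        omega
      have h6 : (n - tParam n) * 8 ≤ 2 ^ tParam n := by omega
      have h7 := Nat.mul_le_mul_left (2 ^ (n + 1 - tParam n)) h6
      rw [h5] at h7
      have h8 : (n - tParam n) * 2 ^ (n + 1 - tParam n) * 2 * 4 =
          2 ^ (n + 1 - tParam n) * ((n - tParam n) * 8) := by ring
      omega
  omega

/-- The modulus of the block syndromes of order `k + 1`. -/
noncomputable def blockModulus (n k : ℕ) : ℕ := 3 * (2 * pParam n) ^ (k + 1)

theorem blockModulus_pos (n k : ℕ) : 0 < blockModulus n k := by
  unfold blockModulus pParam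
  positivity

theorem exists_large_code {n : ℕ} (hn : 1 ≤ n) : ∃ (s₀ s₁ : ℕ) (g g' : Fin 3 → ℕ),
    ValidParams n s₀ s₁ g g' ∧
      ((periodBounded n 2 (tParam n)).ncard : ℝ) ≤
        (5832 * n * (2 * pParam n : ℝ) ^ 12) * ((code11 n s₀ s₁ g g').ncard : ℝ) := by
  classical
  have hRfin : (periodBounded n 2 (tParam n)).Finite :=
    (finite_words n).subset fun x hx => hx.1
  let s : Finset (List Bool) := hRfin.toFinset
  let T : Finset (ℕ × ℕ × (Fin 3 → ℕ) × (Fin 3 → ℕ)) :=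
    Finset.range 4 ×ˢ Finset.range (2 * n) ×ˢ
      (Fintype.piFinset fun k : Fin 3 => Finset.range (blockModulus n k)) ×ˢ
      (Fintype.piFinset fun k : Fin 3 => Finset.range (blockModulus n k))
  let F : List Bool → ℕ × ℕ × (Fin 3 → ℕ) × (Fin 3 → ℕ) := fun x =>
    (vt 0 x % 4, vt 1 x % (2 * n),
      fun k : Fin 3 => oddBlockSum (pParam n) ((k : ℕ) + 1) x % blockModulus n k,
      fun k : Fin 3 => evenBlockSum (pParam n) ((k : ℕ) + 1) x % blockModulus n k)
  have hF : ∀ x, F x ∈ T := fun x => by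
    simp only [F, T, Finset.mem_product, Finset.mem_range, Fintype.mem_piFinset]
    exact ⟨Nat.mod_lt _ (by norm_num), Nat.mod_lt _ (by omega),
      fun k => Nat.mod_lt _ (blockModulus_pos n k), fun k => Nat.mod_lt _ (blockModulus_pos n k)⟩
  have hTcard : (T.card : ℝ) = 5832 * n * (2 * pParam n : ℝ) ^ 12 := by
    simp only [T, Finset.card_product, Finset.card_range, Fintype.card_piFinset,
      Fin.prod_univ_three, blockModulus]
    push_cast
    simp only [Fin.val_zero, Fin.val_one, Fin.val_two]
    ring
  have hTne : T.Nonempty := ⟨F [], hF []⟩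
  have hTpos : (0 : ℝ) < T.card := by exact_mod_cast hTne.card_pos
  obtain ⟨⟨s₀, s₁, g, g'⟩, hmem, hle⟩ := Finset.exists_le_card_fiber_of_nsmul_le_card_of_maps_to
    (s := s) (t := T) (f := F) (b := (s.card : ℝ) / T.card) (fun x _ => hF x) hTne
    (by rw [nsmul_eq_mul, mul_div_cancel₀ _ hTpos.ne'])
  simp only [T, Finset.mem_product, Finset.mem_range, Fintype.mem_piFinset] at hmem
  refine ⟨s₀, s₁, g, g', ⟨hmem.1, hmem.2.1, fun k => ⟨hmem.2.2.1 k, hmem.2.2.2 k⟩⟩, ?_⟩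
  have hcode : (code11 n s₀ s₁ g g').Finite := hRfin.subset fun x hx => hx.1.1
  have hsub : ((s.filter fun x => F x = (s₀, s₁, g, g')).card : ℝ) ≤
      (code11 n s₀ s₁ g g').ncard := by
    rw [← Set.ncard_coe_finset, Nat.cast_le]
    refine Set.ncard_le_ncard (fun x hx => ?_) hcode
    rw [Finset.mem_coe, Finset.mem_filter, Set.Finite.mem_toFinset] at hx
    obtain ⟨hxR, hxF⟩ := hx
    simp only [F, Prod.mk.injEq] at hxF
    obtain ⟨h0, h1, h2, h3⟩ := hxF
    refine ⟨⟨hxR, hxR.1, ?_, ?_⟩, hxR.1, fun k => ⟨?_, ?_⟩⟩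
    · rw [← h0]; exact (Nat.mod_modEq _ _).symm
    · rw [← h1]; exact (Nat.mod_modEq _ _).symm
    · rw [← h2]; exact (Nat.mod_modEq _ _).symm
    · rw [← h3]; exact (Nat.mod_modEq _ _).symm
  have hscard : (s.card : ℝ) = (periodBounded n 2 (tParam n)).ncard := by
    rw [Set.ncard_eq_toFinset_card _ hRfin]
  rw [← hTcard, ← hscard]
  have := hle.trans hsub
  rwa [div_le_iff₀ hTpos, mul_comm] at this

theorem two_mul_pParam_le {n : ℕ} (hn : 2 ≤ n) :
    (2 * pParam n : ℝ) ≤ 128 * Real.logb 2 (n : ℝ) := by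
  have hlog : 1 ≤ Real.logb 2 (n : ℝ) := by
    rw [Real.le_logb_iff_rpow_le (by norm_num) (by positivity), Real.rpow_one]
    exact_mod_cast hn
  have hceil := Nat.ceil_lt_add_one (show 0 ≤ Real.logb 2 (n : ℝ) by linarith)
  unfold pParam tParam
  push_cast
  linarith

theorem exists_code_redundancy_le {n : ℕ} (hn : 2 ≤ n) : ∃ (s₀ s₁ : ℕ) (g g' : Fin 3 → ℕ),
    ValidParams n s₀ s₁ g g' ∧ (code11 n s₀ s₁ g g').Nonempty ∧
      redundancy n (code11 n s₀ s₁ g g') ≤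
        Real.logb 2 (n : ℝ) + 12 * Real.logb 2 (Real.logb 2 (n : ℝ)) + 98 := by
  obtain ⟨s₀, s₁, g, g', hvalid, hle⟩ := exists_large_code (by omega : 1 ≤ n)
  have hlog : 1 ≤ Real.logb 2 (n : ℝ) := by
    rw [Real.le_logb_iff_rpow_le (by norm_num) (by positivity), Real.rpow_one]
    exact_mod_cast hn
  have hR : (2 : ℝ) ^ n ≤ 2 * (periodBounded n 2 (tParam n)).ncard := by
    exact_mod_cast two_pow_le_periodBounded (by omega : 1 ≤ n)
  set c : ℝ := ((code11 n s₀ s₁ g g').ncard : ℝ) with hc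
  have hn0 : (0 : ℝ) < n := by positivity
  have hbound : (2 : ℝ) ^ n ≤ 2 ^ 98 * n * Real.logb 2 (n : ℝ) ^ 12 * c := by
    have hc0 : 0 ≤ c := by positivity
    have hp : (2 * pParam n : ℝ) ^ 12 ≤ (128 * Real.logb 2 (n : ℝ)) ^ 12 :=
      pow_le_pow_left₀ (by positivity) (two_mul_pParam_le hn) 12
    calc (2 : ℝ) ^ n ≤ 2 * ((5832 * n * (2 * pParam n : ℝ) ^ 12) * c) := by linarith
      -- 5832 = 4 · 2 · 3^6 is rounded up to 2^13, so the constant becomes 2^(1 + 13 + 7 · 12) =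
      -- 2^98.
      _ ≤ 2 * ((8192 * n * (128 * Real.logb 2 (n : ℝ)) ^ 12) * c) := by
          gcongr
          norm_num
      _ = 2 ^ 98 * n * Real.logb 2 (n : ℝ) ^ 12 * c := by ring
  have hcpos : 0 < c := by
    have hc0 : 0 ≤ c := by positivity
    rcases hc0.lt_or_eq with h | h
    · exact h
    · rw [← h, mul_zero] at hbound
      have : (0 : ℝ) < 2 ^ n := by positivity
      linarith
  refine ⟨s₀, s₁, g, g', hvalid, ?_, ?_⟩
  · by_contra h
    rw [Set.not_nonempty_iff_eq_empty] at h
    rw [hc, h, Set.ncard_empty, Nat.cast_zero] at hcpos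
    exact lt_irrefl _ hcpos
  · have hl := Real.logb_le_logb_of_le (b := 2) (by norm_num) (by positivity) hbound
    have hlog0 : Real.logb 2 (n : ℝ) ≠ 0 := by linarith
    rw [Real.logb_mul (by positivity) hcpos.ne', Real.logb_mul (by positivity) (by positivity),
      Real.logb_mul (by positivity) hn0.ne', Real.logb_pow, Real.logb_pow, Real.logb_pow,
      Real.logb_self_eq_one (by norm_num)] at hl
    unfold redundancy
    rw [← hc]
    push_cast at hl
    linarith

end Recon

theorem theorem6 :
    (∀ n : ℕ, 1 ≤ n → ∀ (s₀ s₁ : ℕ) (g g' : Fin 3 → ℕ), Recon.ValidParams n s₀ s₁ g g' →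
      Recon.IsReconstructionCode n 11 (Recon.code11 n s₀ s₁ g g')) ∧
    ∃ K : ℝ, ∀ n : ℕ, 2 ≤ n → ∃ (s₀ s₁ : ℕ) (g g' : Fin 3 → ℕ),
      Recon.ValidParams n s₀ s₁ g g' ∧ (Recon.code11 n s₀ s₁ g g').Nonempty ∧
      Recon.redundancy n (Recon.code11 n s₀ s₁ g g') ≤
        Real.logb 2 (n : ℝ) + 12 * Real.logb 2 (Real.logb 2 (n : ℝ)) + K :=
  ⟨fun n hn s₀ s₁ g g' _ => Recon.isReconstructionCode_code11 n s₀ s₁ hn g g',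
    98, fun _ hn => Recon.exists_code_redundancy_le hn⟩
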